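/- **Setting.** Let $n\ge 1$. Consider $\min_{x\in Q}\{F(x)=f(x)+\psi(x)\}$, where $f:\mathbb{R}^n\to\mathbb{R}$ is twice continuously differentiable and its Hessian is Lipschitz, $\|\nabla^2 f(y)-\nabla^2 f(x)\|\le L\|y-x\|$ for all $x,y$ with some $L\ge 0$ (A1; Euclidean and spectral norms); $\psi:\mathbb{R}^n\to\mathbb{R}\cup\{+\infty\}$ is proper, closed, convex, $Q=\operatorname{dom}\psi$, and $\psi$ is twice differentiable on $Q$ (derivatives relative to $Q$: the usual ones at interior points of $Q$, and a fixed choice of them should $Q$ have empty interior, where they are not unique). Let $F^\star=\inf_Q F>-\infty$ and $\xi(y)=\max\{-\lambda_{\min}(\nabla^2F(y)),0\}$ with $\nabla^2F=\nabla^2 f+\nabla^2\psi$. **Inner procedure** $\mathtt{ZeroOrderCubicSteps}(x,B,\sigma,m,\epsilon)$. Put $x_0:=x$. For $t=0,1,\dots,m-1$: with $h_g=3^{-1/3}\bigl[\epsilon m/(\sigma n^{1/2})\bigr]^{1/2}$ compute $g_t^{(i)}=\frac{f(x_t+h_ge_i)-f(x_t-h_ge_i)}{2h_g}$, $i=1,\dots,n$,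 and let $M_t(y)=f(x_t)+\langle g_t,y-x_t\rangle+\frac12\langle B(y-x_t),y-x_t\rangle+\frac\sigma6\|y-x_t\|^3$. Choose any $x_{t+1}\in Q$ and $\psi'(x_{t+1})\in\partial\psi(x_{t+1})$ such that $$M_t(x_{t+1})+\psi(x_{t+1})\le F(x_t),\qquad \|\nabla M_t(x_{t+1})+\psi'(x_{t+1})\|\le\tfrac\sigma4\|x_{t+1}-x_t\|^2,$$ $$B+\sigma\|x_{t+1}-x_t\|I+\nabla^2\psi(x_{t+1})\succeq0 .$$ If $F(x_0)-F(x_{t+1})\ge\frac{\epsilon^{3/2}}{384\,\sigma^{1/2}}(t+1)$, continue; otherwise return $(x_{t+1},\mathtt{halt})$. After $m$ steps without halting return $(x_m,\mathtt{success})$. **Method (zeroth-order CNM).** Given $x_0\in Q$, $\tau_0>0$, $\epsilon>0$, an integer $m\ge1$. At iteration $k=0,1,2,\dots$, for $\ell=0,1,2,\dots$ set $$\sigma_{k,\ell}=2^4\bigl(\tfrac23\bigr)^{1/3}(2^\ell\tau_k)m,\qquad h_{k,\ell}=\Bigl[\tfrac{3^4\sigma_{k,\ell}^{3/2}\epsilon^{3/2}}{2^{14}(192)n^3(2^\ell\tau_k)^3}\Bigr]^{1/3},$$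 compute $B_{k,\ell}=\frac12(A_{k,\ell}+A_{k,\ell}^\top)$ with, for $h=h_{k,\ell}$, $$A_{k,\ell}^{(i,j)}=\frac{f(x_k+he_i+he_j)-f(x_k+he_i)-f(x_k+he_j)+f(x_k)}{h^2},$$ and run $\mathtt{ZeroOrderCubicSteps}(x_k,B_{k,\ell},\sigma_{k,\ell},m,\epsilon)$, whose iterates are denoted $x_{k,\ell}(t)$. If it returns $\mathtt{halt}$, pass to $\ell+1$. If it returns $(\hat x,\mathtt{success})$, put $\ell_k=\ell$, $x_{k+1}=\hat x$, $\tau_{k+1}=\max\{\tau_0,2^{\ell_k-1}\tau_k\}$ and go to iteration $k+1$. **Theorem.** For every run of this method let $T(\epsilon)$ be the first iteration index $k$ such that $$\max\Bigl\{\|\nabla f(x_{k,\ell}(t))+\psi'(x_{k,\ell}(t))\|,\ \frac{1}{2^23^3\,m\max\{\tau_0,L\}}\bigl[\xi(x_{k,\ell}(t))\bigr]^2\Bigr\}\le\epsilon$$ for some $\ell\ge0$ and $t\in\{0,\dots,m\}$ for which $x_{k,\ell}(t)$ is computed; here $\psi'(x_{k,\ell}(t))\in\partial\psi(x_{k,\ell}(t))$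 is, for $t\ge1$, the subgradient chosen along with $x_{k,\ell}(t)$ in the inner procedure, and for $t=0$ any fixed subgradient. Then $T(\epsilon)$ is finite and $$T(\epsilon)\le\frac{(384)\,2^{5/2}(\frac23)^{1/6}\max\{\tau_0,L\}^{1/2}(F(x_0)-F^\star)}{\sqrt m}\,\epsilon^{-3/2},$$ and the total number $\mathrm{ZO}_{T(\epsilon)}$ of evaluations of $f$ during the first $T(\epsilon)$ iterations $k=0,\dots,T(\epsilon)-1$ (including all those made in the inner procedure) satisfies $$\mathrm{ZO}_{T(\epsilon)}\le C\Bigl(\frac{mn+n^2}{\sqrt m}\max\{\tau_0,L\}^{1/2}(F(x_0)-F^\star)\,\epsilon^{-3/2}+(mn+3n^2)\log_2\frac{\max\{\tau_0,L\}}{\tau_0}\Bigr)$$ with an absolute constant $C>0$. -/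

import Mathlib

open scoped ENNReal

noncomputable section

namespace ZOCNM

/-! ### The composite problem `min_{x ∈ Q} F(x) = f(x) + ψ(x)`, `Q = dom ψ` -/

/-- The effective domain `Q = dom ψ` of an extended-real-valued function. -/
def effDom {n : ℕ} (ψ : EuclideanSpace ℝ (Fin n) → EReal) : Set (EuclideanSpace ℝ (Fin n)) :=
  {x | ψ x < ⊤}

/-- `ψ : ℝⁿ → ℝ ∪ {+∞}` is proper, closed and convex. -/
structure IsProperClosedConvex {n : ℕ} (ψ : EuclideanSpace ℝ (Fin n) → EReal) : Prop where
  ne_bot : ∀ x, ψ x ≠ ⊥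
  dom_nonempty : (effDom ψ).Nonempty
  convex_epigraph : Convex ℝ {p : EuclideanSpace ℝ (Fin n) × ℝ | ψ p.1 ≤ (p.2 : EReal)}
  lsc : LowerSemicontinuous ψ

/-- The real value of `ψ`; it is meaningful on `dom ψ` and used only there. -/
def realVal {n : ℕ} (ψ : EuclideanSpace ℝ (Fin n) → EReal) (x : EuclideanSpace ℝ (Fin n)) : ℝ :=
  (ψ x).toReal

/-- The objective `F = f + ψ` on `Q = dom ψ`. -/
def objective {n : ℕ} (f : EuclideanSpace ℝ (Fin n) → ℝ) (ψ : EuclideanSpace ℝ (Fin n) → EReal)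
    (x : EuclideanSpace ℝ (Fin n)) : ℝ :=
  f x + realVal ψ x

/-- `F⋆ = inf_{x ∈ Q} F(x)`. -/
def optVal {n : ℕ} (f : EuclideanSpace ℝ (Fin n) → ℝ) (ψ : EuclideanSpace ℝ (Fin n) → EReal) : ℝ :=
  sInf (objective f ψ '' effDom ψ)

/-- `s ∈ ∂ψ(x)`. -/
def IsSubgradient {n : ℕ} (ψ : EuclideanSpace ℝ (Fin n) → EReal)
    (s x : EuclideanSpace ℝ (Fin n)) : Prop :=
  x ∈ effDom ψ ∧ ∀ y, ψ x + ((inner ℝ s (y - x) : ℝ) : EReal) ≤ ψ y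

/-- The Hessian of `f`, as a bilinear form; the operator norm of this form is the spectral norm. -/
def hess {n : ℕ} (f : EuclideanSpace ℝ (Fin n) → ℝ) (x : EuclideanSpace ℝ (Fin n)) :
    EuclideanSpace ℝ (Fin n) →L[ℝ] EuclideanSpace ℝ (Fin n) →L[ℝ] ℝ :=
  fderiv ℝ (fderiv ℝ f) x

/-- The Hessian of `ψ` relative to its domain `Q`, as a bilinear form. At interior points of `Q`
(at all points of `Q`, if `Q` is open) this is the usual Hessian. -/
def hessComposite {n : ℕ} (ψ : EuclideanSpace ℝ (Fin n) → EReal) (x : EuclideanSpace ℝ (Fin n)) :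
    EuclideanSpace ℝ (Fin n) →L[ℝ] EuclideanSpace ℝ (Fin n) →L[ℝ] ℝ :=
  fderivWithin ℝ (fderivWithin ℝ (realVal ψ) (effDom ψ)) (effDom ψ) x

/-- `ψ` is twice differentiable on its domain `Q` (relative to `Q`). -/
def TwiceDifferentiable {n : ℕ} (ψ : EuclideanSpace ℝ (Fin n) → EReal) : Prop :=
  DifferentiableOn ℝ (realVal ψ) (effDom ψ) ∧
    DifferentiableOn ℝ (fderivWithin ℝ (realVal ψ) (effDom ψ)) (effDom ψ)

/-- The smallest eigenvalue of a symmetric bilinear form: the minimum of its quadratic form over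
the unit sphere. -/
def lambdaMin {n : ℕ}
    (H : EuclideanSpace ℝ (Fin n) →L[ℝ] EuclideanSpace ℝ (Fin n) →L[ℝ] ℝ) : ℝ :=
  ⨅ v : Metric.sphere (0 : EuclideanSpace ℝ (Fin n)) 1,
    H (v : EuclideanSpace ℝ (Fin n)) (v : EuclideanSpace ℝ (Fin n))

/-- `ξ(y) = max{-λ_min(∇²F(y)), 0}` with `∇²F = ∇²f + ∇²ψ`. -/
def xi {n : ℕ} (f : EuclideanSpace ℝ (Fin n) → ℝ) (ψ : EuclideanSpace ℝ (Fin n) → EReal)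
    (y : EuclideanSpace ℝ (Fin n)) : ℝ :=
  max (-lambdaMin (hess f y + hessComposite ψ y)) 0

/-! ### Finite differences, with the points at which they evaluate `f` -/

/-- The standard basis vector `e_i`. -/
def e {n : ℕ} (i : Fin n) : EuclideanSpace ℝ (Fin n) := EuclideanSpace.single i 1

/-- Central differences for the gradient. -/
def fdGrad {n : ℕ} (f : EuclideanSpace ℝ (Fin n) → ℝ) (x : EuclideanSpace ℝ (Fin n)) (h : ℝ) :
    EuclideanSpace ℝ (Fin n) :=
  WithLp.toLp 2 fun i => (f (x + h • e i) - f (x - h • e i)) / (2 * h)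

/-- The points at which `fdGrad f x h` evaluates `f`. -/
def fdGradQueries {n : ℕ} (x : EuclideanSpace ℝ (Fin n)) (h : ℝ) :
    List (EuclideanSpace ℝ (Fin n)) :=
  (List.finRange n).flatMap fun i => [x + h • e i, x - h • e i]

/-- The matrix `A` of second-order forward differences. -/
def fdMatrix {n : ℕ} (f : EuclideanSpace ℝ (Fin n) → ℝ) (x : EuclideanSpace ℝ (Fin n)) (h : ℝ) :
    Matrix (Fin n) (Fin n) ℝ :=
  Matrix.of fun i j =>
    (f (x + h • e i + h • e j) - f (x + h • e i) - f (x + h • e j) + f x) / h ^ 2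

/-- The Hessian approximation `B = (A + Aᵀ) / 2`. -/
def fdHess {n : ℕ} (f : EuclideanSpace ℝ (Fin n) → ℝ) (x : EuclideanSpace ℝ (Fin n)) (h : ℝ) :
    Matrix (Fin n) (Fin n) ℝ :=
  (1 / 2 : ℝ) • (fdMatrix f x h + (fdMatrix f x h).transpose)

/-- The points at which `fdHess f x h` evaluates `f`; no value is reused. -/
def fdHessQueries {n : ℕ} (x : EuclideanSpace ℝ (Fin n)) (h : ℝ) :
    List (EuclideanSpace ℝ (Fin n)) :=
  (List.finRange n).flatMap fun i => (List.finRange n).flatMap fun j =>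
    [x + h • e i + h • e j, x + h • e i, x + h • e j, x]

/-! ### One inexact cubic step -/

/-- The quadratic form `⟨B v, v⟩`. -/
def quadForm {n : ℕ} (B : Matrix (Fin n) (Fin n) ℝ) (v : EuclideanSpace ℝ (Fin n)) : ℝ :=
  inner ℝ (Matrix.toEuclideanLin B v) v

/-- The model `M(y) = f(x) + ⟨g, y - x⟩ + ½⟨B(y - x), y - x⟩ + (σ/6)‖y - x‖³`. -/
def cubicModel {n : ℕ} (f : EuclideanSpace ℝ (Fin n) → ℝ) (g : EuclideanSpace ℝ (Fin n))
    (B : Matrix (Fin n) (Fin n) ℝ) (σ : ℝ) (x y : EuclideanSpace ℝ (Fin n)) : ℝ :=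
  f x + inner ℝ g (y - x) + 1 / 2 * quadForm B (y - x) + σ / 6 * ‖y - x‖ ^ 3

/-- `xp` is an admissible approximate minimizer of `M + ψ` over `Q`, with the subgradient
`s ∈ ∂ψ(xp)` as first-order certificate, and with the second-order condition
`B + σ‖xp - x‖ I + ∇²ψ(xp) ⪰ 0`. -/
structure IsInexactStep {n : ℕ} (f : EuclideanSpace ℝ (Fin n) → ℝ)
    (ψ : EuclideanSpace ℝ (Fin n) → EReal) (g : EuclideanSpace ℝ (Fin n))
    (B : Matrix (Fin n) (Fin n) ℝ) (σ : ℝ) (x xp s : EuclideanSpace ℝ (Fin n)) : Prop where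
  subgradient : IsSubgradient ψ s xp
  decrease : cubicModel f g B σ x xp + realVal ψ xp ≤ objective f ψ x
  stationary : ‖gradient (cubicModel f g B σ x) xp + s‖ ≤ σ / 4 * ‖xp - x‖ ^ 2
  second_order : ∀ v : EuclideanSpace ℝ (Fin n),
    0 ≤ quadForm B v + σ * ‖xp - x‖ * ‖v‖ ^ 2 + hessComposite ψ xp v v

/-! ### The inner procedure `ZeroOrderCubicSteps(x, B, σ, m, ε)` -/

/-- The difference step `h_g` for the gradients. -/
def gradStep (n m : ℕ) (σ ε : ℝ) : ℝ :=
  1 / (3 : ℝ) ^ (1 / 3 : ℝ) * (ε * m / (σ * (n : ℝ) ^ (1 / 2 : ℝ))) ^ (1 / 2 : ℝ)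

/-- The progress test made after the iterate `y (t + 1)` has been computed from `y t`. -/
def TestPassed {n : ℕ} (f : EuclideanSpace ℝ (Fin n) → ℝ) (ψ : EuclideanSpace ℝ (Fin n) → EReal)
    (σ ε : ℝ) (y : ℕ → EuclideanSpace ℝ (Fin n)) (t : ℕ) : Prop :=
  objective f ψ (y 0) - objective f ψ (y (t + 1)) ≥
    ε ^ (3 / 2 : ℝ) / (384 * σ ^ (1 / 2 : ℝ)) * ((t : ℝ) + 1)

/-- The procedure performs the step from `y t` to `y (t + 1)`: it has made fewer than `m` steps and
has not halted before. -/
def StepPerformed {n : ℕ} (f : EuclideanSpace ℝ (Fin n) → ℝ)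
    (ψ : EuclideanSpace ℝ (Fin n) → EReal) (σ : ℝ) (m : ℕ) (ε : ℝ)
    (y : ℕ → EuclideanSpace ℝ (Fin n)) (t : ℕ) : Prop :=
  t < m ∧ ∀ r < t, TestPassed f ψ σ ε y r

/-- The iterate `y t` is computed: it is the starting point or the result of a performed step. -/
def IterateComputed {n : ℕ} (f : EuclideanSpace ℝ (Fin n) → ℝ)
    (ψ : EuclideanSpace ℝ (Fin n) → EReal) (σ : ℝ) (m : ℕ) (ε : ℝ)
    (y : ℕ → EuclideanSpace ℝ (Fin n)) (t : ℕ) : Prop :=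
  t = 0 ∨ ∃ r, t = r + 1 ∧ StepPerformed f ψ σ m ε y r

/-- The procedure returns `success` (otherwise it returns `halt`). -/
def Success {n : ℕ} (f : EuclideanSpace ℝ (Fin n) → ℝ) (ψ : EuclideanSpace ℝ (Fin n) → EReal)
    (σ : ℝ) (m : ℕ) (ε : ℝ) (y : ℕ → EuclideanSpace ℝ (Fin n)) : Prop :=
  ∀ t < m, TestPassed f ψ σ ε y t

/-- `y` is a sequence of iterates that the procedure, with the second-order condition on the
subproblem solutions, can generate; entries of `y` that are not computed are unconstrained.
`s t ∈ ∂ψ(y t)` is the subgradient attached to `y t`: the certificate of the step that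
computed `y t`, and any subgradient for the starting point. -/
structure IsZeroOrderCubicSteps {n : ℕ} (f : EuclideanSpace ℝ (Fin n) → ℝ)
    (ψ : EuclideanSpace ℝ (Fin n) → EReal) (x : EuclideanSpace ℝ (Fin n))
    (B : Matrix (Fin n) (Fin n) ℝ) (σ : ℝ) (m : ℕ) (ε : ℝ)
    (y s : ℕ → EuclideanSpace ℝ (Fin n)) : Prop where
  start : y 0 = x
  subgradient_start : IsSubgradient ψ (s 0) (y 0)
  step : ∀ t, StepPerformed f ψ σ m ε y t →
    IsInexactStep f ψ (fdGrad f (y t) (gradStep n m σ ε)) B σ (y t) (y (t + 1)) (s (t + 1))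

/-- The points at which step `t` of the procedure evaluates `f`: those of the gradient
approximation, `y t` (model value), and `y 0`, `y (t + 1)` (progress test); no value is reused. -/
def stepQueries {n : ℕ} (m : ℕ) (σ ε : ℝ) (y : ℕ → EuclideanSpace ℝ (Fin n)) (t : ℕ) :
    List (EuclideanSpace ℝ (Fin n)) :=
  fdGradQueries (y t) (gradStep n m σ ε) ++ [y t, y 0, y (t + 1)]

/-! ### The zeroth-order cubic Newton method -/

/-- `σ_{k,ℓ}`, as a function of `τ = τ_k`. -/
def sigma (m : ℕ) (τ : ℝ) (ℓ : ℕ) : ℝ :=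
  2 ^ 4 * (2 / 3 : ℝ) ^ (1 / 3 : ℝ) * (2 ^ ℓ * τ) * m

/-- `h_{k,ℓ}`, as a function of `τ = τ_k`. -/
def hessStep (n m : ℕ) (ε τ : ℝ) (ℓ : ℕ) : ℝ :=
  (3 ^ 4 * sigma m τ ℓ ^ (3 / 2 : ℝ) * ε ^ (3 / 2 : ℝ) /
    (2 ^ 14 * 192 * (n : ℝ) ^ 3 * (2 ^ ℓ * τ) ^ 3)) ^ (1 / 3 : ℝ)

/-- The data produced by the method: `x k = x_k`, `τ k = τ_k`, `y k ℓ t = x_{k,ℓ}(t)`, and the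
subgradient `s k ℓ t` of `ψ` at `x_{k,ℓ}(t)`. Only the entries that the method reaches matter. -/
structure Trace (n : ℕ) where
  x : ℕ → EuclideanSpace ℝ (Fin n)
  τ : ℕ → ℝ
  y : ℕ → ℕ → ℕ → EuclideanSpace ℝ (Fin n)
  s : ℕ → ℕ → ℕ → EuclideanSpace ℝ (Fin n)

/-- The inner procedure called at iteration `k` with search index `ℓ` returns `success`. -/
def Trace.CallSuccess {n : ℕ} (R : Trace n) (f : EuclideanSpace ℝ (Fin n) → ℝ)
    (ψ : EuclideanSpace ℝ (Fin n) → EReal) (m : ℕ) (ε : ℝ) (k ℓ : ℕ) : Prop :=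
  Success f ψ (sigma m (R.τ k) ℓ) m ε (R.y k ℓ)

/-- The method calls the inner procedure at iteration `k` with search index `ℓ`. -/
inductive Trace.Reached {n : ℕ} (R : Trace n) (f : EuclideanSpace ℝ (Fin n) → ℝ)
    (ψ : EuclideanSpace ℝ (Fin n) → EReal) (m : ℕ) (ε : ℝ) : ℕ → ℕ → Prop
  | start : R.Reached f ψ m ε 0 0
  | retry (k ℓ : ℕ) : R.Reached f ψ m ε k ℓ → ¬ R.CallSuccess f ψ m ε k ℓ →
      R.Reached f ψ m ε k (ℓ + 1)
  | next (k ℓ : ℕ) : R.Reached f ψ m ε k ℓ → R.CallSuccess f ψ m ε k ℓ →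
      R.Reached f ψ m ε (k + 1) 0

/-- `R` is a run of the zeroth-order cubic Newton method (with the second-order condition on the
subproblem solutions) from `x₀` with parameters `τ₀`, `m`, `ε`. -/
structure IsRun {n : ℕ} (f : EuclideanSpace ℝ (Fin n) → ℝ)
    (ψ : EuclideanSpace ℝ (Fin n) → EReal) (x₀ : EuclideanSpace ℝ (Fin n)) (τ₀ : ℝ) (m : ℕ)
    (ε : ℝ) (R : Trace n) : Prop where
  x_zero : R.x 0 = x₀
  τ_zero : R.τ 0 = τ₀
  call : ∀ k ℓ, R.Reached f ψ m ε k ℓ →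
    IsZeroOrderCubicSteps f ψ (R.x k) (fdHess f (R.x k) (hessStep n m ε (R.τ k) ℓ))
      (sigma m (R.τ k) ℓ) m ε (R.y k ℓ) (R.s k ℓ)
  x_succ : ∀ k ℓ, R.Reached f ψ m ε k ℓ → R.CallSuccess f ψ m ε k ℓ →
    R.x (k + 1) = R.y k ℓ m
  τ_succ : ∀ k ℓ, R.Reached f ψ m ε k ℓ → R.CallSuccess f ψ m ε k ℓ →
    R.τ (k + 1) = max τ₀ ((2 : ℝ) ^ ((ℓ : ℤ) - 1) * R.τ k)

open Classical in
/-- The number of evaluations of `f` made by the call of the inner procedure at `(k, ℓ)`,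
including the computation of the Hessian approximation that it uses. -/
def Trace.callEvals {n : ℕ} (R : Trace n) (f : EuclideanSpace ℝ (Fin n) → ℝ)
    (ψ : EuclideanSpace ℝ (Fin n) → EReal) (m : ℕ) (ε : ℝ) (k ℓ : ℕ) : ℕ :=
  (fdHessQueries (R.x k) (hessStep n m ε (R.τ k) ℓ)).length +
    ∑ t ∈ Finset.range m,
      if StepPerformed f ψ (sigma m (R.τ k) ℓ) m ε (R.y k ℓ) t then
        (stepQueries m (sigma m (R.τ k) ℓ) ε (R.y k ℓ) t).length
      else 0

open Classical in
/-- `ZO_T`: the total number of evaluations of `f` during the first `T` iterations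
`k = 0, …, T - 1`. It is infinite if the search over `ℓ` does not end in one of them. -/
def Trace.totalEvals {n : ℕ} (R : Trace n) (f : EuclideanSpace ℝ (Fin n) → ℝ)
    (ψ : EuclideanSpace ℝ (Fin n) → EReal) (m : ℕ) (ε : ℝ) (T : ℕ) : ℝ≥0∞ :=
  ∑ k ∈ Finset.range T, ∑' ℓ : ℕ,
    if R.Reached f ψ m ε k ℓ then (R.callEvals f ψ m ε k ℓ : ℝ≥0∞) else 0

/-- At iteration `k`, some computed iterate `x_{k,ℓ}(t)`, `0 ≤ t ≤ m`, satisfies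
`max{‖∇f + ψ'‖, ξ² / (2² 3³ m M)} ≤ ε`. -/
def Trace.FindsSecondOrderPoint {n : ℕ} (R : Trace n) (f : EuclideanSpace ℝ (Fin n) → ℝ)
    (ψ : EuclideanSpace ℝ (Fin n) → EReal) (m : ℕ) (ε M : ℝ) (k : ℕ) : Prop :=
  ∃ ℓ t : ℕ, R.Reached f ψ m ε k ℓ ∧ t ≤ m ∧
    IterateComputed f ψ (sigma m (R.τ k) ℓ) m ε (R.y k ℓ) t ∧
    max ‖gradient f (R.y k ℓ t) + R.s k ℓ t‖
      (1 / (2 ^ 2 * 3 ^ 3 * m * M) * xi f ψ (R.y k ℓ t) ^ 2) ≤ ε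

end ZOCNM

end

/-! The core is one call of the inner procedure with `2 ^ ℓ * τ ≥ L` (`success_of_not_found`). Then
`L ≤ σ / (13 m)`, and everything scales: lengths are measured in units of `√(ε/σ)`, decreases in
units of `ε^(3/2) / σ^(1/2)`. The difference steps keep the gradient error below `ε / 78` and the
initial Hessian error below `√(εσ) / 16`. The Hessian is not recomputed, so its error grows with the
distance from the starting point, but only at rate `1 / (13 m)` per unit of length.

Two facts about a step follow. Its decrease is at least a multiple of its length cubed, minus error
terms. If the path so far has length at most `m` and the step is shorter than one unit, its endpoint
is already an approximate second-order point. So if no such point occurs, either all steps are long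
or the path is longer than `m`; in both cases the sum of the cubed lengths is at least the number of
steps. Young's inequality absorbs the errors, and every progress test is passed
(`card_div_le_sum_decrease`).

Hence, until a point is found, the doubling search stops with `2 ^ ℓ * τ ≤ 2 * max τ₀ L`, so `τ`
never exceeds `max τ₀ L`. Each iteration lowers the objective by a fixed `iterDecrease`, which
bounds `T`. The number of calls telescopes through `log₂ τ` (`IsRun.invariants`). -/

open scoped ENNReal

noncomputable section

namespace ZOCNM

/-! ### Taylor estimates for a function with Lipschitz Hessian. -/

section Taylor

/-- If `φ` vanishes at `0` and its derivative is bounded by that of `C s ^ (k + 1)` on `[0, 1]`,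
then `φ 1` is bounded by `C`. -/
theorem norm_image_one_le_of_norm_deriv_le_pow {F : Type*} [NormedAddCommGroup F] [NormedSpace ℝ F]
    {φ φ' : ℝ → F} {C : ℝ} (k : ℕ) (h0 : φ 0 = 0) (hφ : ∀ s, HasDerivAt φ (φ' s) s)
    (hb : ∀ s, 0 ≤ s → ‖φ' s‖ ≤ C * ((k + 1 : ℕ) * s ^ k)) : ‖φ 1‖ ≤ C := by
  have := image_norm_le_of_norm_deriv_right_le_deriv_boundary (f := φ) (f' := φ')
    (a := 0) (b := 1) (B := fun s => C * s ^ (k + 1)) (B' := fun s => C * ((k + 1 : ℕ) * s ^ k))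
    (fun s _ => (hφ s).continuousAt.continuousWithinAt) (fun s _ => (hφ s).hasDerivWithinAt)
    (by simp [h0])
    (fun s => by simpa using (hasDerivAt_pow (k + 1) s).const_mul C)
    (fun s hs => hb s hs.1)
  simpa using this (Set.right_mem_Icc.2 zero_le_one)

variable {n : ℕ} {f : EuclideanSpace ℝ (Fin n) → ℝ} {L : ℝ}

theorem hasDerivAt_line (x d : EuclideanSpace ℝ (Fin n)) (s : ℝ) :
    HasDerivAt (fun s : ℝ => x + s • d) d s := by
  simpa using ((hasDerivAt_id s).smul_const d).const_add x

theorem norm_fderiv_add_sub_le (hf : ContDiff ℝ 2 f)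
    (hL : ∀ x y, ‖hess f y - hess f x‖ ≤ L * ‖y - x‖) (x d : EuclideanSpace ℝ (Fin n)) :
    ‖fderiv ℝ f (x + d) - fderiv ℝ f x - hess f x d‖ ≤ L / 2 * ‖d‖ ^ 2 := by
  have hd : Differentiable ℝ (fderiv ℝ f) :=
    (hf.fderiv_right (m := 1) (by norm_num)).differentiable (by norm_num)
  have := norm_image_one_le_of_norm_deriv_le_pow
    (φ := fun s : ℝ => fderiv ℝ f (x + s • d) - fderiv ℝ f x - s • hess f x d)
    (φ' := fun s => hess f (x + s • d) d - hess f x d) (C := L / 2 * ‖d‖ ^ 2) 1 (by simp)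
    (fun s => by
      have h1 := (hd (x + s • d)).hasFDerivAt.comp_hasDerivAt s (hasDerivAt_line x d s)
      refine ((h1.sub_const (fderiv ℝ f x)).sub
        ((hasDerivAt_id s).smul_const (hess f x d))).congr_deriv ?_
      simp [hess])
    (fun s hs => by
      have h1 := (hess f (x + s • d) - hess f x).le_of_opNorm_le (hL x (x + s • d)) d
      rw [sub_apply] at h1
      refine h1.trans (le_of_eq ?_)
      rw [add_sub_cancel_left, norm_smul, Real.norm_of_nonneg hs]
      push_cast
      ring)
  simpa using this

/-- Along the segment, the derivative of the second-order remainder is the first-order remainder of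
`fderiv ℝ f`, applied to `d`; so the preceding bound is integrated once more. -/
theorem abs_taylor_two_le (hf : ContDiff ℝ 2 f)
    (hL : ∀ x y, ‖hess f y - hess f x‖ ≤ L * ‖y - x‖) (x d : EuclideanSpace ℝ (Fin n)) :
    |f (x + d) - f x - fderiv ℝ f x d - 1 / 2 * hess f x d d| ≤ L / 6 * ‖d‖ ^ 3 := by
  have hd : Differentiable ℝ f := hf.differentiable (by norm_num)
  have := norm_image_one_le_of_norm_deriv_le_pow
    (φ := fun s : ℝ => f (x + s • d) - f x - s * fderiv ℝ f x d - s ^ 2 * (1 / 2 * hess f x d d))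
    (φ' := fun s => (fderiv ℝ f (x + s • d) - fderiv ℝ f x - hess f x (s • d)) d)
    (C := L / 6 * ‖d‖ ^ 3) 2 (by simp)
    (fun s => by
      have h1 := (hd (x + s • d)).hasFDerivAt.comp_hasDerivAt s (hasDerivAt_line x d s)
      have h2 := ((h1.sub_const (f x)).sub
        ((hasDerivAt_id s).mul_const (fderiv ℝ f x d))).sub
        ((hasDerivAt_pow 2 s).mul_const (1 / 2 * hess f x d d))
      refine h2.congr_deriv ?_
      simp only [sub_apply, map_smul, smul_apply,
        smul_eq_mul]
      push_cast
      ring)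
    (fun s hs => by
      refine (ContinuousLinearMap.le_of_opNorm_le _ (norm_fderiv_add_sub_le hf hL x (s • d))
        d).trans (le_of_eq ?_)
      rw [norm_smul, Real.norm_of_nonneg hs]
      push_cast
      ring)
  simpa using this

theorem hess_comm (hf : ContDiff ℝ 2 f) (x u v : EuclideanSpace ℝ (Fin n)) :
    hess f x u v = hess f x v u :=
  (hf.contDiffAt (x := x)).isSymmSndFDerivAt (by simp) u v

/-- The even-order terms cancel between the expansions at `w` and `-w`. -/
theorem abs_central_difference_sub_le (hf : ContDiff ℝ 2 f)
    (hL : ∀ x y, ‖hess f y - hess f x‖ ≤ L * ‖y - x‖) (x w : EuclideanSpace ℝ (Fin n)) :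
    |f (x + w) - f (x - w) - 2 * fderiv ℝ f x w| ≤ L / 3 * ‖w‖ ^ 3 := by
  have h1 := abs_le.1 (abs_taylor_two_le hf hL x w)
  have h2 := abs_le.1 (abs_taylor_two_le hf hL x (-w))
  simp only [map_neg, norm_neg, neg_apply, neg_neg, ← sub_eq_add_neg] at h2
  rw [abs_le]
  constructor <;> linarith [h1.1, h1.2, h2.1, h2.2]

/-- Expanding at `u`, `v` and `u + v` leaves only the mixed Hessian term, by symmetry; the
remainders add up to `(1 + 1 + 8) / 6 ≤ 2` times `L h ^ 3`. -/
theorem abs_second_difference_sub_le (hf : ContDiff ℝ 2 f) (hL0 : 0 ≤ L)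
    (hL : ∀ x y, ‖hess f y - hess f x‖ ≤ L * ‖y - x‖) (x u v : EuclideanSpace ℝ (Fin n)) {h : ℝ}
    (hu : ‖u‖ ≤ h) (hv : ‖v‖ ≤ h) :
    |f (x + u + v) - f (x + u) - f (x + v) + f x - hess f x u v| ≤ 2 * L * h ^ 3 := by
  have h1 := abs_le.1 (abs_taylor_two_le hf hL x u)
  have h2 := abs_le.1 (abs_taylor_two_le hf hL x v)
  have h3 := abs_le.1 (abs_taylor_two_le hf hL x (u + v))
  have e1 : L / 6 * ‖u‖ ^ 3 ≤ L / 6 * h ^ 3 := by gcongr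
  have e2 : L / 6 * ‖v‖ ^ 3 ≤ L / 6 * h ^ 3 := by gcongr
  have e3 : L / 6 * ‖u + v‖ ^ 3 ≤ L / 6 * (2 * h) ^ 3 := by
    gcongr
    linarith [norm_add_le u v]
  have e4 : 0 ≤ L * h ^ 3 := by
    have := (norm_nonneg u).trans hu
    positivity
  have hc := hess_comm hf x v u
  simp only [map_add, add_apply, ← add_assoc] at h3
  rw [abs_le]
  constructor <;> nlinarith [h1.1, h1.2, h2.1, h2.2, h3.1, h3.2]

end Taylor

/-! ### Errors of the finite-difference gradient and Hessian. -/

section FiniteDifferences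

variable {n : ℕ} {f : EuclideanSpace ℝ (Fin n) → ℝ} {L : ℝ}

theorem sum_abs_le_sqrt_mul_norm (w : EuclideanSpace ℝ (Fin n)) :
    ∑ i, |w i| ≤ Real.sqrt n * ‖w‖ := by
  have h := sq_sum_le_card_mul_sum_sq (s := Finset.univ) (f := fun i => |w i|)
  simp only [sq_abs, Finset.card_univ, Fintype.card_fin] at h
  rw [EuclideanSpace.norm_eq, ← Real.sqrt_mul (Nat.cast_nonneg n)]
  refine Real.le_sqrt_of_sq_le ?_
  simpa using h

theorem sum_smul_e (w : EuclideanSpace ℝ (Fin n)) : ∑ i, w i • (e i : EuclideanSpace ℝ (Fin n)) = w := by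
  simpa [e] using (EuclideanSpace.basisFun (Fin n) ℝ).sum_repr w

theorem norm_smul_e {h : ℝ} (hh : 0 ≤ h) (i : Fin n) :
    ‖h • (e i : EuclideanSpace ℝ (Fin n))‖ = h := by
  simp [e, norm_smul, abs_of_nonneg hh]

theorem abs_inner_fdGrad_sub_le (hf : ContDiff ℝ 2 f) (hL0 : 0 ≤ L)
    (hL : ∀ x y, ‖hess f y - hess f x‖ ≤ L * ‖y - x‖) (x w : EuclideanSpace ℝ (Fin n))
    {h : ℝ} (hh : 0 < h) :
    |inner ℝ (fdGrad f x h) w - fderiv ℝ f x w| ≤ L / 6 * h ^ 2 * Real.sqrt n * ‖w‖ := by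
  have hc : ∀ i, |(f (x + h • e i) - f (x - h • e i)) / (2 * h) - fderiv ℝ f x (e i)|
      ≤ L / 6 * h ^ 2 := by
    intro i
    have h1 := abs_central_difference_sub_le hf hL x (h • e i)
    rw [norm_smul_e hh.le, map_smul, smul_eq_mul] at h1
    have : (f (x + h • e i) - f (x - h • e i)) / (2 * h) - fderiv ℝ f x (e i)
        = (f (x + h • e i) - f (x - h • e i) - 2 * (h * fderiv ℝ f x (e i))) / (2 * h) := by
      field_simp
    rw [this, abs_div, abs_of_pos (by positivity : 0 < 2 * h), div_le_iff₀ (by positivity)]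
    linarith
  have hw : fderiv ℝ f x w = ∑ i, w i * fderiv ℝ f x (e i) := by
    conv_lhs => rw [← sum_smul_e w]
    simp
  have hg : inner ℝ (fdGrad f x h) w
      = ∑ i, w i * ((f (x + h • e i) - f (x - h • e i)) / (2 * h)) := by
    simp [PiLp.inner_apply, fdGrad]
  rw [hw, hg, ← Finset.sum_sub_distrib]
  calc _ ≤ ∑ i, |w i| * (L / 6 * h ^ 2) := by
        refine (Finset.abs_sum_le_sum_abs _ _).trans (Finset.sum_le_sum fun i _ => ?_)
        rw [← mul_sub, abs_mul]
        gcongr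
        exact hc i
    _ ≤ _ := by
        rw [← Finset.sum_mul]
        nlinarith [mul_le_mul_of_nonneg_right (sum_abs_le_sqrt_mul_norm w)
          (by positivity : 0 ≤ L / 6 * h ^ 2)]

theorem abs_fdHess_sub_le (hf : ContDiff ℝ 2 f) (hL0 : 0 ≤ L)
    (hL : ∀ x y, ‖hess f y - hess f x‖ ≤ L * ‖y - x‖) (x : EuclideanSpace ℝ (Fin n))
    {h : ℝ} (hh : 0 < h) (i j : Fin n) :
    |fdHess f x h i j - hess f x (e j) (e i)| ≤ 2 * L * h := by
  have h1 := abs_second_difference_sub_le hf hL0 hL x (h • e j) (h • e i)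
    (norm_smul_e hh.le j).le (norm_smul_e hh.le i).le
  have : fdHess f x h i j - hess f x (e j) (e i)
      = (f (x + h • e j + h • e i) - f (x + h • e j) - f (x + h • e i) + f x
        - hess f x (h • e j) (h • e i)) / h ^ 2 := by
    simp only [fdHess, fdMatrix, Matrix.smul_apply, Matrix.add_apply, Matrix.transpose_apply,
      Matrix.of_apply, smul_eq_mul, map_smul, smul_apply]
    rw [add_right_comm x (h • e i) (h • e j)]
    field_simp
    ring
  rw [this, abs_div, abs_of_pos (by positivity : 0 < h ^ 2), div_le_iff₀ (by positivity)]
  linarith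

/-- Each entry is off by at most `2 L h`; the two `ℓ¹` norms cost a factor `√n` each. -/
theorem abs_inner_fdHess_sub_le (hf : ContDiff ℝ 2 f) (hL0 : 0 ≤ L)
    (hL : ∀ x y, ‖hess f y - hess f x‖ ≤ L * ‖y - x‖) (x v w : EuclideanSpace ℝ (Fin n))
    {h : ℝ} (hh : 0 < h) :
    |inner ℝ (Matrix.toEuclideanLin (fdHess f x h) v) w - hess f x v w|
      ≤ 2 * L * h * n * ‖v‖ * ‖w‖ := by
  have hH : hess f x v w = ∑ i, ∑ j, w i * v j * hess f x (e j) (e i) := by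
    conv_lhs => rw [← sum_smul_e w, ← sum_smul_e v]
    simp only [map_sum, map_smul, sum_apply, smul_apply, smul_eq_mul, Finset.mul_sum]
    exact Finset.sum_congr rfl fun i _ => Finset.sum_congr rfl fun j _ => by ring
  have hB : inner ℝ (Matrix.toEuclideanLin (fdHess f x h) v) w
      = ∑ i, ∑ j, w i * v j * fdHess f x h i j := by
    simp only [PiLp.inner_apply, Matrix.toLpLin_apply, Matrix.mulVec, dotProduct,
      RCLike.inner_apply, conj_trivial, Finset.mul_sum]
    exact Finset.sum_congr rfl fun i _ => Finset.sum_congr rfl fun j _ => by ring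
  rw [hH, hB, ← Finset.sum_sub_distrib]
  simp_rw [← Finset.sum_sub_distrib]
  calc _ ≤ ∑ i, ∑ j, |w i| * |v j| * (2 * L * h) := by
        refine (Finset.abs_sum_le_sum_abs _ _).trans (Finset.sum_le_sum fun i _ => ?_)
        refine (Finset.abs_sum_le_sum_abs _ _).trans (Finset.sum_le_sum fun j _ => ?_)
        rw [← mul_sub, abs_mul, abs_mul]
        gcongr
        exact abs_fdHess_sub_le hf hL0 hL x hh i j
    _ = (∑ i, |w i|) * (∑ j, |v j|) * (2 * L * h) := by
        simp_rw [← Finset.sum_mul, Finset.sum_mul_sum]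
    _ ≤ (Real.sqrt n * ‖w‖) * (Real.sqrt n * ‖v‖) * (2 * L * h) := by
        gcongr <;> exact sum_abs_le_sqrt_mul_norm _
    _ = _ := by
        have := Real.mul_self_sqrt (Nat.cast_nonneg (α := ℝ) n)
        linear_combination (‖w‖ * ‖v‖ * (2 * L * h)) * this

theorem inner_fdHess_comm (x v w : EuclideanSpace ℝ (Fin n)) (h : ℝ) :
    inner ℝ (Matrix.toEuclideanLin (fdHess f x h) v) w
      = inner ℝ (Matrix.toEuclideanLin (fdHess f x h) w) v := by
  have hs : ∀ i j, fdHess f x h i j = fdHess f x h j i := fun i j => by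
    simp [fdHess, add_comm]
  simp only [PiLp.inner_apply, Matrix.toLpLin_apply, Matrix.mulVec, dotProduct,
    RCLike.inner_apply, conj_trivial, Finset.mul_sum]
  rw [Finset.sum_comm]
  exact Finset.sum_congr rfl fun i _ => Finset.sum_congr rfl fun j _ => by rw [hs]; ring

end FiniteDifferences

/-! ### A numerical inequality for step lengths and decreases. -/

/-- Summation argument for the cubic steps, in normalized units: `ρ i` is the length of step `i`,
`D i` its decrease. -/
theorem card_div_le_sum_decrease {N m : ℕ} (hN : N ≤ m) {ρ D : ℕ → ℝ} (h0 : ∀ i, 0 ≤ ρ i)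
    (hlong : ∀ i < N, ∑ j ∈ Finset.range i, ρ j ≤ m → 1 ≤ ρ i)
    (hD : ∀ i < N, 2 / 13 * ρ i ^ 3 - 1 / 78 * ρ i
      - 1 / 2 * (1 / (13 * m) * ∑ j ∈ Finset.range i, ρ j + 1 / 16) * ρ i ^ 2 ≤ D i) :
    (N : ℝ) / 384 ≤ ∑ i ∈ Finset.range N, D i := by
  rcases Nat.eq_zero_or_pos N with rfl | hpos
  · simp
  have hm : (0 : ℝ) < m := by exact_mod_cast hpos.trans_le hN
  have hNm : (N : ℝ) ≤ m := by exact_mod_cast hN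
  set P := ∑ i ∈ Finset.range N, ρ i ^ 3 with hP
  have young1 : ∀ a : ℝ, 0 ≤ a → a ≤ (a ^ 3 + 2) / 3 := fun a ha => by
    nlinarith [mul_nonneg (by linarith : (0:ℝ) ≤ a + 2) (sq_nonneg (a - 1))]
  have young2 : ∀ a : ℝ, 0 ≤ a → a ^ 2 ≤ (2 * a ^ 3 + 1) / 3 := fun a ha => by
    nlinarith [mul_nonneg (by linarith : (0:ℝ) ≤ 2 * a + 1) (sq_nonneg (a - 1))]
  have young3 : ∀ a b : ℝ, 0 ≤ a → 0 ≤ b → a * b ^ 2 ≤ (a ^ 3 + 2 * b ^ 3) / 3 :=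
    fun a b ha hb => by
      nlinarith [mul_nonneg (by linarith : (0:ℝ) ≤ a + 2 * b) (sq_nonneg (a - b))]
  have hS1 : ∑ i ∈ Finset.range N, ρ i ≤ (P + 2 * N) / 3 := by
    calc _ ≤ ∑ i ∈ Finset.range N, (ρ i ^ 3 + 2) / 3 :=
          Finset.sum_le_sum fun i _ => young1 _ (h0 i)
      _ = _ := by rw [← Finset.sum_div, Finset.sum_add_distrib]; simp [hP, mul_comm]
  have hS2 : ∑ i ∈ Finset.range N, ρ i ^ 2 ≤ (2 * P + N) / 3 := by
    calc _ ≤ ∑ i ∈ Finset.range N, (2 * ρ i ^ 3 + 1) / 3 :=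
          Finset.sum_le_sum fun i _ => young2 _ (h0 i)
      _ = _ := by rw [← Finset.sum_div, Finset.sum_add_distrib, ← Finset.mul_sum]; simp [hP]
  have hmono : ∀ i < N, ∑ j ∈ Finset.range i, ρ j ≤ ∑ j ∈ Finset.range N, ρ j := fun i hi =>
    Finset.sum_le_sum_of_subset_of_nonneg (Finset.range_mono hi.le) fun j _ _ => h0 j
  -- If `P < N`, then `hS1` makes the total length less than `N ≤ m`, so every step is long, which
  -- forces `P ≥ N`.
  have hPN : (N : ℝ) ≤ P := by
    by_contra! hlt
    have : ∀ i ∈ Finset.range N, (1 : ℝ) ≤ ρ i ^ 3 := fun i hi => by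
      have hi := Finset.mem_range.1 hi
      exact one_le_pow₀ (hlong i hi (by linarith [hmono i hi]))
    have := Finset.sum_le_sum this
    simp at this
    linarith
  have hS3 : ∑ i ∈ Finset.range N, (∑ j ∈ Finset.range i, ρ j) * ρ i ^ 2 ≤ m * P := by
    calc _ ≤ ∑ i ∈ Finset.range N, (∑ j ∈ Finset.range N, ρ j) * ρ i ^ 2 :=
          Finset.sum_le_sum fun i hi =>
            mul_le_mul_of_nonneg_right (hmono i (Finset.mem_range.1 hi)) (sq_nonneg _)
      _ = ∑ i ∈ Finset.range N, ∑ j ∈ Finset.range N, ρ j * ρ i ^ 2 := by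
          simp_rw [Finset.sum_mul]
      _ ≤ ∑ i ∈ Finset.range N, ∑ j ∈ Finset.range N, (ρ j ^ 3 + 2 * ρ i ^ 3) / 3 :=
          Finset.sum_le_sum fun i _ => Finset.sum_le_sum fun j _ => young3 _ _ (h0 j) (h0 i)
      _ = N * P := by
          simp_rw [← Finset.sum_div, Finset.sum_add_distrib]
          simp only [Finset.sum_const, Finset.card_range, nsmul_eq_mul, ← Finset.mul_sum, ← hP]
          ring
      _ ≤ m * P := by
          have : (0 : ℝ) ≤ N := Nat.cast_nonneg N
          gcongr
          linarith
  have hsum := Finset.sum_le_sum fun i hi => hD i (Finset.mem_range.1 hi)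
  have hexp : ∑ i ∈ Finset.range N, (2 / 13 * ρ i ^ 3 - 1 / 78 * ρ i
      - 1 / 2 * (1 / (13 * m) * ∑ j ∈ Finset.range i, ρ j + 1 / 16) * ρ i ^ 2)
      = 2 / 13 * P - 1 / 78 * ∑ i ∈ Finset.range N, ρ i
        - 1 / (26 * m) * ∑ i ∈ Finset.range N, (∑ j ∈ Finset.range i, ρ j) * ρ i ^ 2
        - 1 / 32 * ∑ i ∈ Finset.range N, ρ i ^ 2 := by
    rw [hP, Finset.mul_sum, Finset.mul_sum, Finset.mul_sum, Finset.mul_sum,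
      ← Finset.sum_sub_distrib, ← Finset.sum_sub_distrib, ← Finset.sum_sub_distrib]
    refine Finset.sum_congr rfl fun i _ => ?_
    field_simp
    ring
  have hS3' : 1 / (26 * m) * ∑ i ∈ Finset.range N, (∑ j ∈ Finset.range i, ρ j) * ρ i ^ 2
      ≤ 1 / 26 * P := by
    calc _ ≤ 1 / (26 * m) * (m * P) := by gcongr
      _ = _ := by field_simp
  -- After `hS1`, `hS2` and `hS3'`, the bound `P ≥ N` leaves about `0.07 N`, well above `N / 384`.
  rw [hexp] at hsum
  have : (0 : ℝ) ≤ N := Nat.cast_nonneg N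
  linarith

/-! ### Consequences of one inexact cubic step. -/

section CubicStep

variable {n : ℕ} {f : EuclideanSpace ℝ (Fin n) → ℝ} {ψ : EuclideanSpace ℝ (Fin n) → EReal}
  {L σ δ η : ℝ} {B : Matrix (Fin n) (Fin n) ℝ} {g x xp s : EuclideanSpace ℝ (Fin n)}

theorem hasFDerivAt_cubicModel
    (hB : ∀ v w, inner ℝ (Matrix.toEuclideanLin B v) w = inner ℝ (Matrix.toEuclideanLin B w) v)
    (g x y : EuclideanSpace ℝ (Fin n)) :
    HasFDerivAt (cubicModel f g B σ x)
      (innerSL ℝ (g + Matrix.toEuclideanLin B (y - x) + (σ / 2 * ‖y - x‖) • (y - x))) y := by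
  have hs : HasFDerivAt (fun y => y - x) (ContinuousLinearMap.id ℝ (EuclideanSpace ℝ (Fin n))) y :=
    (hasFDerivAt_id y).sub_const x
  have h1 : HasFDerivAt (fun y => inner ℝ g (y - x)) (innerSL ℝ g) y :=
    (innerSL ℝ g).hasFDerivAt.comp y hs
  have h2 := ((Matrix.toEuclideanLin B).toContinuousLinearMap.hasFDerivAt.comp y hs).inner ℝ hs
  -- The real exponent gives access to `hasFDerivAt_norm_rpow`, which also covers `y = x`.
  have h3 : HasFDerivAt (fun y => ‖y - x‖ ^ (3 : ℝ))
      ((3 * ‖y - x‖ ^ ((3 : ℝ) - 2)) • innerSL ℝ (y - x)) y :=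
    (HasFDerivAt.comp (g := fun z => ‖z‖ ^ (3 : ℝ)) y
      (hasFDerivAt_norm_rpow (y - x) (by norm_num : (1 : ℝ) < 3)) hs).congr_fderiv
      (ContinuousLinearMap.comp_id _)
  have h := ((h1.const_add (f x)).add (h2.const_mul (1 / 2))).add (h3.const_mul (σ / 6))
  have hfun : cubicModel f g B σ x = fun y => f x + inner ℝ g (y - x)
      + 1 / 2 * inner ℝ (Matrix.toEuclideanLin B (y - x)) (y - x)
      + σ / 6 * ‖y - x‖ ^ (3 : ℝ) := by
    funext y
    simp only [cubicModel, quadForm]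
    norm_cast
  rw [hfun]
  refine h.congr_fderiv ?_
  ext w
  have e1 : (3 : ℝ) - 2 = 1 := by norm_num
  have e2 := hB w (y - x)
  simp only [e1, Real.rpow_one]
  simp [fderivInnerCLM_apply, e2, real_inner_comm, inner_sub_right]
  ring

theorem norm_gradient_sub_le {G : EuclideanSpace ℝ (Fin n) → ℝ} {z v : EuclideanSpace ℝ (Fin n)}
    {c : ℝ} (hc : 0 ≤ c) (h : ∀ w, |fderiv ℝ G z w - inner ℝ v w| ≤ c * ‖w‖) : ‖gradient G z - v‖ ≤ c := by
  set u := gradient G z - v with hu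
  rcases eq_or_ne u 0 with h0 | h0
  · simpa [h0] using hc
  · have := (le_abs_self _).trans (h u)
    rw [← inner_gradient_left, ← inner_sub_left, ← hu, real_inner_self_eq_norm_mul_norm] at this
    exact le_of_mul_le_mul_right this (norm_pos_iff.2 h0)

/-- One step decreases the objective, up to the errors `δ` of the gradient and `η` of the
Hessian. -/
theorem IsInexactStep.decrease_le (hstep : IsInexactStep f ψ g B σ x xp s) (hf : ContDiff ℝ 2 f)
    (hL : ∀ x y, ‖hess f y - hess f x‖ ≤ L * ‖y - x‖)
    (hg : ∀ w, |inner ℝ g w - fderiv ℝ f x w| ≤ δ * ‖w‖)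
    (hBη : ∀ v w, |inner ℝ (Matrix.toEuclideanLin B v) w - hess f x v w| ≤ η * ‖v‖ * ‖w‖) :
    (σ - L) / 6 * ‖xp - x‖ ^ 3 - δ * ‖xp - x‖ - 1 / 2 * η * ‖xp - x‖ ^ 2
      ≤ objective f ψ x - objective f ψ xp := by
  have h1 := abs_le.1 (abs_taylor_two_le hf hL x (xp - x))
  have h2 := abs_le.1 (hg (xp - x))
  have h3 := abs_le.1 (hBη (xp - x) (xp - x))
  have h4 := hstep.decrease
  simp only [cubicModel, quadForm] at h4
  rw [add_sub_cancel] at h1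
  have : objective f ψ xp = f xp + realVal ψ xp := rfl
  linarith [h1.1, h1.2, h2.1, h2.2, h3.1, h3.2]

/-- The gradient of the model differs from `∇f` by the Taylor, gradient and Hessian errors and the
cubic term; the latter contributes `σ / 2` and the stationarity tolerance `σ / 4`. -/
theorem IsInexactStep.norm_gradient_add_le (hstep : IsInexactStep f ψ g B σ x xp s)
    (hf : ContDiff ℝ 2 f) (hL : ∀ x y, ‖hess f y - hess f x‖ ≤ L * ‖y - x‖) (hσ : 0 ≤ σ)
    (hδ : 0 ≤ δ) (hη : 0 ≤ η) (hL0 : 0 ≤ L)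
    (hB : ∀ v w, inner ℝ (Matrix.toEuclideanLin B v) w = inner ℝ (Matrix.toEuclideanLin B w) v)
    (hg : ∀ w, |inner ℝ g w - fderiv ℝ f x w| ≤ δ * ‖w‖)
    (hBη : ∀ v w, |inner ℝ (Matrix.toEuclideanLin B v) w - hess f x v w| ≤ η * ‖v‖ * ‖w‖) :
    ‖gradient f xp + s‖ ≤ (3 / 4 * σ + L / 2) * ‖xp - x‖ ^ 2 + δ + η * ‖xp - x‖ := by
  set d := xp - x with hd
  have hgrad : gradient (cubicModel f g B σ x) xp
      = g + Matrix.toEuclideanLin B d + (σ / 2 * ‖d‖) • d :=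
    HasGradientAt.gradient (hasFDerivAt_cubicModel hB g x xp)
  have h1 : ‖gradient f xp - (g + Matrix.toEuclideanLin B d)‖ ≤ L / 2 * ‖d‖ ^ 2 + δ + η * ‖d‖ := by
    refine norm_gradient_sub_le (by positivity) fun w => ?_
    have t := ContinuousLinearMap.le_of_opNorm_le _ (norm_fderiv_add_sub_le hf hL x d) w
    rw [hd, add_sub_cancel, ← hd, Real.norm_eq_abs] at t
    simp only [sub_apply] at t
    have t := abs_le.1 t
    have h2 := abs_le.1 (hg w)
    have h3 := abs_le.1 (hBη d w)
    rw [inner_add_left, abs_le]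
    constructor <;> linarith [t.1, t.2, h2.1, h2.2, h3.1, h3.2]
  have h2 := hstep.stationary
  rw [hgrad, ← hd] at h2
  have h3 : ‖(σ / 2 * ‖d‖) • d‖ = σ / 2 * ‖d‖ ^ 2 := by
    rw [norm_smul, Real.norm_of_nonneg (by positivity)]
    ring
  have : gradient f xp + s = (gradient f xp - (g + Matrix.toEuclideanLin B d))
      + (g + Matrix.toEuclideanLin B d + (σ / 2 * ‖d‖) • d + s) - (σ / 2 * ‖d‖) • d := by
    abel
  rw [this]
  refine (norm_sub_le _ _).trans ?_
  linarith [norm_add_le (gradient f xp - (g + Matrix.toEuclideanLin B d))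
    (g + Matrix.toEuclideanLin B d + (σ / 2 * ‖d‖) • d + s)]

/-- In the second-order condition, replacing `B` by the Hessian at `x` costs `η`, and moving that
Hessian to `xp` costs `L * ‖xp - x‖`. -/
theorem IsInexactStep.xi_le (hn : 0 < n) (hstep : IsInexactStep f ψ g B σ x xp s)
    (hL : ∀ x y, ‖hess f y - hess f x‖ ≤ L * ‖y - x‖) (hσ : 0 ≤ σ)
    (hη : 0 ≤ η) (hL0 : 0 ≤ L)
    (hBη : ∀ v w, |inner ℝ (Matrix.toEuclideanLin B v) w - hess f x v w| ≤ η * ‖v‖ * ‖w‖) :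
    xi f ψ xp ≤ (σ + L) * ‖xp - x‖ + η := by
  -- For `n > 0` the unit sphere is nonempty, so `lambdaMin` is a genuine infimum rather than the
  -- default value `0`.
  have : Nonempty (Metric.sphere (0 : EuclideanSpace ℝ (Fin n)) 1) :=
    ⟨⟨e ⟨0, hn⟩, by simp [e]⟩⟩
  refine max_le (neg_le.1 (le_ciInf fun v => ?_)) (by positivity)
  have hv : ‖(v : EuclideanSpace ℝ (Fin n))‖ = 1 := by simp
  have h1 := hstep.second_order v
  have h2 := abs_le.1 (hBη v v)
  have h3 := ContinuousLinearMap.le_of_opNorm_le _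
    (ContinuousLinearMap.le_of_opNorm_le _ (hL x xp) v) (v : EuclideanSpace ℝ (Fin n))
  simp only [sub_apply, Real.norm_eq_abs] at h3
  have h3 := abs_le.1 h3
  simp only [quadForm, hv, add_apply] at *
  linarith [h2.1, h2.2, h3.1, h3.2]

end CubicStep

/-! ### The regularization parameter and the difference steps. -/

section Parameters

theorem rpow_three_halves {a : ℝ} (ha : 0 ≤ a) : a ^ (3 / 2 : ℝ) = Real.sqrt a ^ 3 := by
  rw [Real.sqrt_eq_rpow, ← Real.rpow_natCast, ← Real.rpow_mul ha]
  norm_num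

theorem rpow_one_third_pow {a : ℝ} (ha : 0 ≤ a) : (a ^ (1 / 3 : ℝ)) ^ 3 = a := by
  rw [← Real.rpow_natCast, ← Real.rpow_mul ha]
  norm_num

/-- The constant `16 (2/3)^(1/3)` is about `13.98`; integer bounds for it suffice throughout the
inner analysis. -/
theorem sigma_bounds {m : ℕ} {τ : ℝ} (hτ : 0 ≤ τ) (ℓ : ℕ) :
    13 * (2 ^ ℓ * τ) * m ≤ sigma m τ ℓ ∧ sigma m τ ℓ ≤ 14 * (2 ^ ℓ * τ) * m := by
  have h3 := rpow_one_third_pow (a := 2 / 3) (by norm_num)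
  have h0 : (0 : ℝ) ≤ (2 / 3 : ℝ) ^ (1 / 3 : ℝ) := by positivity
  unfold sigma
  set c := (2 / 3 : ℝ) ^ (1 / 3 : ℝ)
  have h1 : 13 / 16 ≤ c := by
    by_contra! h
    have := pow_lt_pow_left₀ h h0 (by norm_num : (3 : ℕ) ≠ 0)
    rw [h3] at this
    norm_num at this
  have h2 : c ≤ 7 / 8 := by
    by_contra! h
    have := pow_lt_pow_left₀ h (by norm_num) (by norm_num : (3 : ℕ) ≠ 0)
    rw [h3] at this
    norm_num at this
  have hp : 0 ≤ 2 ^ ℓ * τ * m := by positivity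
  constructor <;> nlinarith

theorem gradStep_pos {n m : ℕ} {σ ε : ℝ} (hn : 0 < n) (hm : 0 < m) (hσ : 0 < σ) (hε : 0 < ε) :
    0 < gradStep n m σ ε := by
  unfold gradStep
  positivity

theorem gradStep_sq_mul_le {n m : ℕ} {σ ε : ℝ} (hn : 0 < n) (hm : 0 < m) (hσ : 0 < σ)
    (hε : 0 < ε) : gradStep n m σ ε ^ 2 * Real.sqrt n ≤ ε * m / σ := by
  have hs : 0 < Real.sqrt n := Real.sqrt_pos.2 (by exact_mod_cast hn)
  unfold gradStep
  rw [mul_pow, ← Real.sqrt_eq_rpow, ← Real.sqrt_eq_rpow, Real.sq_sqrt (by positivity)]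
  have h1 : (1 / (3 : ℝ) ^ (1 / 3 : ℝ)) ^ 2 ≤ 1 := by
    refine pow_le_one₀ (by positivity) ?_
    rw [div_le_one (by positivity)]
    exact Real.one_le_rpow (by norm_num) (by norm_num)
  calc _ = (1 / (3 : ℝ) ^ (1 / 3 : ℝ)) ^ 2 * (ε * m / σ) := by field_simp
    _ ≤ 1 * (ε * m / σ) := by gcongr
    _ = _ := one_mul _

theorem hessStep_pos {n m : ℕ} {ε τ : ℝ} (hn : 0 < n) (hm : 0 < m) (hε : 0 < ε) (hτ : 0 < τ)
    (ℓ : ℕ) : 0 < hessStep n m ε τ ℓ := by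
  have : 0 < sigma m τ ℓ := by
    unfold sigma
    positivity
  unfold hessStep
  positivity

/-- After cubing, `n` and `2 ^ ℓ * τ` cancel by the choice of `hessStep`, and there remains `3 ^ 4 /
(2 ^ 14 * 192) ≤ 1 / 32 ^ 3`. -/
theorem hessStep_mul_le {n m : ℕ} {ε τ : ℝ} (hn : 0 < n) (hm : 0 < m) (hε : 0 < ε) (hτ : 0 < τ)
    (ℓ : ℕ) : (2 ^ ℓ * τ) * hessStep n m ε τ ℓ * n
      ≤ Real.sqrt (sigma m τ ℓ) * Real.sqrt ε / 32 := by
  have hh := hessStep_pos hn hm hε hτ ℓ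
  have hσ : 0 < sigma m τ ℓ := by
    unfold sigma
    positivity
  refine le_of_pow_le_pow_left₀ (by norm_num : (3 : ℕ) ≠ 0) (by positivity) ?_
  have h3 : hessStep n m ε τ ℓ ^ 3 = 3 ^ 4 * Real.sqrt (sigma m τ ℓ) ^ 3 * Real.sqrt ε ^ 3 /
    (2 ^ 14 * 192 * (n : ℝ) ^ 3 * (2 ^ ℓ * τ) ^ 3) := by
    unfold hessStep
    rw [rpow_one_third_pow (by positivity), rpow_three_halves hσ.le, rpow_three_halves hε.le]
  have hn' : (0 : ℝ) < n := by exact_mod_cast hn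
  rw [mul_pow, mul_pow, h3]
  have : (2 ^ ℓ * τ) ^ 3 * (3 ^ 4 * Real.sqrt (sigma m τ ℓ) ^ 3 * Real.sqrt ε ^ 3 /
      (2 ^ 14 * 192 * (n : ℝ) ^ 3 * (2 ^ ℓ * τ) ^ 3)) * n ^ 3
      = 3 ^ 4 / (2 ^ 14 * 192) * (Real.sqrt (sigma m τ ℓ) ^ 3 * Real.sqrt ε ^ 3) := by
    field_simp
  rw [this, div_pow, mul_pow]
  have : 0 ≤ Real.sqrt (sigma m τ ℓ) ^ 3 * Real.sqrt ε ^ 3 := by positivity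
  linarith

end Parameters

/-! ### Success of the inner procedure once the Lipschitz constant is overestimated. -/

section InnerProcedure

variable {n m : ℕ} {f : EuclideanSpace ℝ (Fin n) → ℝ} {ψ : EuclideanSpace ℝ (Fin n) → EReal}
  {L M τ ε : ℝ} {ℓ : ℕ} {x : EuclideanSpace ℝ (Fin n)} {y s : ℕ → EuclideanSpace ℝ (Fin n)}

set_option maxHeartbeats 1000000 in
/-- If `2 ^ ℓ τ` overestimates the Lipschitz constant, the inner procedure succeeds unless it finds
an approximate second-order point. -/
theorem success_of_not_found (hn : 0 < n) (hf : ContDiff ℝ 2 f) (hL0 : 0 ≤ L)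
    (hL : ∀ x y, ‖hess f y - hess f x‖ ≤ L * ‖y - x‖) (hτ : 0 < τ) (hε : 0 < ε) (hm : 0 < m)
    (hM : 0 < M) (hLτ : L ≤ 2 ^ ℓ * τ) (hτM : 2 ^ ℓ * τ ≤ 2 * M)
    (hrun : IsZeroOrderCubicSteps f ψ x (fdHess f x (hessStep n m ε τ ℓ)) (sigma m τ ℓ) m ε y s)
    (hnot : ∀ t ≤ m, IterateComputed f ψ (sigma m τ ℓ) m ε y t →
      ε < max ‖gradient f (y t) + s t‖ (1 / (2 ^ 2 * 3 ^ 3 * m * M) * xi f ψ (y t) ^ 2)) :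
    Success f ψ (sigma m τ ℓ) m ε y := by
  obtain ⟨hσ1, hσ2⟩ := sigma_bounds (m := m) hτ.le ℓ
  have hmR : (1 : ℝ) ≤ m := by exact_mod_cast hm
  have hτ' : 0 < 2 ^ ℓ * τ := by positivity
  have hσ : 0 < sigma m τ ℓ := lt_of_lt_of_le (by positivity) hσ1
  have hhH := hessStep_pos hn hm hε hτ ℓ
  have hhHle := hessStep_mul_le hn hm hε hτ ℓ
  set T := 2 ^ ℓ * τ
  set h := hessStep n m ε τ ℓ
  set σ := sigma m τ ℓ
  have hhg := gradStep_pos hn hm hσ hε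
  have hhgle := gradStep_sq_mul_le hn hm hσ hε
  set k := gradStep n m σ ε
  have hLσm : L ≤ σ / (13 * m) := by
    rw [le_div_iff₀ (by positivity)]
    nlinarith
  have hLσ : L ≤ σ / 13 := hLσm.trans (by gcongr; linarith)
  have hL' : ∀ x y, ‖hess f y - hess f x‖ ≤ σ / 13 * ‖y - x‖ := fun x y =>
    (hL x y).trans (by gcongr)
  obtain ⟨a, ha, hae⟩ : ∃ a, 0 < a ∧ a = Real.sqrt ε := ⟨_, Real.sqrt_pos.2 hε, rfl⟩
  obtain ⟨b, hb, hbe⟩ : ∃ b, 0 < b ∧ b = Real.sqrt σ := ⟨_, Real.sqrt_pos.2 hσ, rfl⟩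
  have ha2 : ε = a ^ 2 := by rw [hae, Real.sq_sqrt hε.le]
  have hb2 : σ = b ^ 2 := by rw [hbe, Real.sq_sqrt hσ.le]
  rw [← hae, ← hbe] at hhHle
  -- Normalized lengths: the unit is `a / b = √(ε/σ)`.
  obtain ⟨ρ, hρ⟩ : ∃ ρ : ℕ → ℝ, ∀ i, ‖y (i + 1) - y i‖ = ρ i * (a / b) :=
    ⟨fun i => ‖y (i + 1) - y i‖ / (a / b), fun i => by field_simp⟩
  have hρ0 : ∀ i, 0 ≤ ρ i := fun i => by
    have := norm_nonneg (y (i + 1) - y i)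
    rw [hρ] at this
    exact nonneg_of_mul_nonneg_left this (by positivity)
  have hgrad : ∀ i w, |inner ℝ (fdGrad f (y i) k) w - fderiv ℝ f (y i) w| ≤ a ^ 2 / 78 * ‖w‖ := by
    intro i w
    refine (abs_inner_fdGrad_sub_le hf hL0 hL (y i) w hhg).trans ?_
    gcongr
    calc L / 6 * k ^ 2 * Real.sqrt n = L / 6 * (k ^ 2 * Real.sqrt n) := by ring
      _ ≤ (σ / (13 * m)) / 6 * (ε * m / σ) := by gcongr
      _ = a ^ 2 / 78 := by rw [ha2]; field_simp; norm_num
  -- The sum is the drift from `x`, where the Hessian was approximated; `1 / 16` is the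
  -- finite-difference error.
  have hhess : ∀ i v w, |inner ℝ (Matrix.toEuclideanLin (fdHess f x h) v) w - hess f (y i) v w|
      ≤ a * b * (1 / (13 * m) * ∑ j ∈ Finset.range i, ρ j + 1 / 16) * ‖v‖ * ‖w‖ := by
    intro i v w
    have h1 := abs_le.1 (abs_inner_fdHess_sub_le hf hL0 hL x v w hhH)
    have h2 := ContinuousLinearMap.le_of_opNorm_le _
      (ContinuousLinearMap.le_of_opNorm_le _ (hL x (y i)) v) w
    simp only [sub_apply, Real.norm_eq_abs] at h2
    have h2 := abs_le.1 h2
    have h3 : ‖y i - x‖ ≤ (∑ j ∈ Finset.range i, ρ j) * (a / b) := by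
      have := dist_le_range_sum_dist y i
      rw [dist_comm, dist_eq_norm, hrun.start] at this
      refine this.trans_eq ?_
      rw [Finset.sum_mul]
      exact Finset.sum_congr rfl fun j _ => by rw [dist_comm, dist_eq_norm, hρ]
    have hS : 0 ≤ ∑ j ∈ Finset.range i, ρ j := Finset.sum_nonneg fun j _ => hρ0 j
    have h4 : L * ‖y i - x‖ ≤ a * b * (1 / (13 * m) * ∑ j ∈ Finset.range i, ρ j) := by
      calc _ ≤ (σ / (13 * m)) * ((∑ j ∈ Finset.range i, ρ j) * (a / b)) := by gcongr
        _ = _ := by rw [hb2]; field_simp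
    have h5 : 2 * L * h * n ≤ a * b * (1 / 16) := by
      have : L * h * n ≤ T * h * n := by gcongr
      linarith
    have h6 : (L * ‖y i - x‖ + 2 * L * h * n) * ‖v‖ * ‖w‖ ≤
        a * b * (1 / (13 * m) * ∑ j ∈ Finset.range i, ρ j + 1 / 16) * ‖v‖ * ‖w‖ := by
      gcongr
      linarith
    rw [abs_le]
    constructor <;> linarith [h1.1, h1.2, h2.1, h2.2]
  have hsymm := fun v w => inner_fdHess_comm (f := f) x v w h
  intro t
  -- The earlier tests must have been passed for the steps up to `t` to be performed, and only
  -- performed steps satisfy `hrun.step`.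
  induction t using Nat.strong_induction_on with
  | _ t ih =>
  intro ht
  have hperf : ∀ i ≤ t, StepPerformed f ψ σ m ε y i := fun i hi =>
    ⟨hi.trans_lt ht, fun r hr => ih r (hr.trans_le hi) ((hr.trans_le hi).trans ht)⟩
  have key := card_div_le_sum_decrease (N := t + 1) (m := m) (ρ := ρ)
    (D := fun i => (objective f ψ (y i) - objective f ψ (y (i + 1))) * (b / a ^ 3)) ht hρ0 ?_ ?_
  · rw [← Finset.sum_mul, Finset.sum_range_sub'] at key
    unfold TestPassed
    rw [rpow_three_halves hε.le, ← hae, ← Real.sqrt_eq_rpow, ← hbe, ge_iff_le]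
    calc _ = ((t + 1 : ℕ) : ℝ) / 384 * (a ^ 3 / b) := by push_cast; field_simp
      _ ≤ (objective f ψ (y 0) - objective f ψ (y (t + 1))) * (b / a ^ 3) * (a ^ 3 / b) := by
        gcongr
      _ = _ := by field_simp
  -- A short step after a short path would end at an approximate second-order point: the gradient
  -- bound is `3/4 + 1/26 + 1/78 + 1/13 + 1/16 < 1` times `ε`.
  · intro i hi hS
    by_contra! hlt
    have hstep := hrun.step i (hperf i (by omega))
    have hη : a * b * (1 / (13 * m) * ∑ j ∈ Finset.range i, ρ j + 1 / 16)
        ≤ a * b * (1 / 13 + 1 / 16) := by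
      gcongr
      calc _ ≤ 1 / (13 * m) * (m : ℝ) := by gcongr
        _ = 1 / 13 := by field_simp
    have hhess' : ∀ v w, |inner ℝ (Matrix.toEuclideanLin (fdHess f x h) v) w - hess f (y i) v w|
        ≤ a * b * (1 / 13 + 1 / 16) * ‖v‖ * ‖w‖ := fun v w =>
      (hhess i v w).trans (by gcongr)
    have hr : ‖y (i + 1) - y i‖ ≤ a / b := by
      rw [hρ]
      exact mul_le_of_le_one_left (by positivity) hlt.le
    rcases lt_max_iff.1 (hnot (i + 1) (by omega) (Or.inr ⟨i, rfl, hperf i (by omega)⟩)) with hc | hc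
    · have h1 := hstep.norm_gradient_add_le hf hL' hσ.le (by positivity) (by positivity)
        (by positivity) hsymm (hgrad i) hhess'
      have h2 : (3 / 4 * σ + σ / 13 / 2) * ‖y (i + 1) - y i‖ ^ 2 + a ^ 2 / 78
          + a * b * (1 / 13 + 1 / 16) * ‖y (i + 1) - y i‖
          ≤ (3 / 4 * σ + σ / 13 / 2) * (a / b) ^ 2 + a ^ 2 / 78
          + a * b * (1 / 13 + 1 / 16) * (a / b) := by gcongr
      have h3 : (3 / 4 * σ + σ / 13 / 2) * (a / b) ^ 2 + a ^ 2 / 78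
          + a * b * (1 / 13 + 1 / 16) * (a / b)
          = (3 / 4 + 1 / 26 + 1 / 78 + (1 / 13 + 1 / 16)) * a ^ 2 := by
        rw [hb2]
        field_simp
        ring
      nlinarith [pow_pos ha 2]
    · have h1 := hstep.xi_le hn hL' hσ.le (by positivity) (by positivity) hhess'
      have h2 : (σ + σ / 13) * ‖y (i + 1) - y i‖ + a * b * (1 / 13 + 1 / 16)
          ≤ (σ + σ / 13) * (a / b) + a * b * (1 / 13 + 1 / 16) := by gcongr
      have h3 : (σ + σ / 13) * (a / b) + a * b * (1 / 13 + 1 / 16)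
          = (1 + 1 / 13 + 1 / 13 + 1 / 16) * (a * b) := by
        rw [hb2]
        field_simp
        ring
      have h4 : xi f ψ (y (i + 1)) ^ 2 ≤ ((1 + 1 / 13 + 1 / 13 + 1 / 16) * (a * b)) ^ 2 :=
        pow_le_pow_left₀ (le_max_right _ _) (h1.trans (h2.trans_eq h3)) 2
      rw [one_div_mul_eq_div, lt_div_iff₀ (by positivity)] at hc
      -- Here `28 = 14 * 2`, from `hσ2` and `hτM`. The squared constant for `xi` times `28` is about
      -- `41`, below `2 ^ 2 * 3 ^ 3 = 108`.
      have h5 : σ * ε ≤ 28 * (m * M) * ε := by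
        gcongr
        nlinarith
      have h6 : σ * ε = (a * b) ^ 2 := by rw [ha2, hb2]; ring
      rw [mul_pow, ← h6] at h4
      have h7 : 0 < m * M * ε := by positivity
      norm_num at h4 hc
      linarith
  · intro i hi
    have h1 := (hrun.step i (hperf i (by omega))).decrease_le hf hL' (hgrad i) (hhess i)
    rw [hρ] at h1
    calc _ = ((σ - σ / 13) / 6 * (ρ i * (a / b)) ^ 3 - a ^ 2 / 78 * (ρ i * (a / b))
          - 1 / 2 * (a * b * (1 / (13 * m) * ∑ j ∈ Finset.range i, ρ j + 1 / 16))
            * (ρ i * (a / b)) ^ 2) * (b / a ^ 3) := by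
          rw [hb2]
          generalize ∑ j ∈ Finset.range i, ρ j = S
          field_simp
          ring
      _ ≤ _ := by gcongr

end InnerProcedure

/-! ### The search over `ℓ`, the decrease per iteration and the evaluation count. -/

section Method

variable {n m : ℕ} {f : EuclideanSpace ℝ (Fin n) → ℝ} {ψ : EuclideanSpace ℝ (Fin n) → EReal}
  {L M τ₀ ε : ℝ} {x₀ : EuclideanSpace ℝ (Fin n)} {R : Trace n}

theorem Trace.Reached.not_callSuccess {k ℓ : ℕ} (h : R.Reached f ψ m ε k ℓ) :
    ∀ ℓ' < ℓ, ¬ R.CallSuccess f ψ m ε k ℓ' := by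
  induction h with
  | start => simp
  | retry k ℓ _ hns ih =>
    intro ℓ' hℓ'
    rcases Nat.lt_succ_iff_lt_or_eq.1 hℓ' with h | rfl
    · exact ih ℓ' h
    · exact hns
  | next => simp

theorem Trace.reached_of_not_callSuccess {k : ℕ} (h0 : R.Reached f ψ m ε k 0) (ℓ : ℕ)
    (h : ∀ ℓ' < ℓ, ¬ R.CallSuccess f ψ m ε k ℓ') : R.Reached f ψ m ε k ℓ := by
  induction ℓ with
  | zero => exact h0
  | succ ℓ ih => exact .retry k ℓ (ih fun ℓ' hℓ' => h ℓ' (by omega)) (h ℓ (by omega))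

/-- The search over `ℓ` ends with `2 ^ ℓ τ ≤ 2 M` in an iteration that does not find an
approximate second-order point. -/
theorem IsRun.exists_callSuccess (hR : IsRun f ψ x₀ τ₀ m ε R) (hn : 0 < n) (hf : ContDiff ℝ 2 f)
    (hL0 : 0 ≤ L) (hL : ∀ x y, ‖hess f y - hess f x‖ ≤ L * ‖y - x‖) (hε : 0 < ε) (hm : 0 < m)
    (hLM : L ≤ M) {k : ℕ} (hτ : 0 < R.τ k) (hτM : R.τ k ≤ M) (h0 : R.Reached f ψ m ε k 0)
    (hnot : ¬ R.FindsSecondOrderPoint f ψ m ε M k) :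
    ∃ ℓ, R.CallSuccess f ψ m ε k ℓ ∧ R.Reached f ψ m ε k ℓ ∧ 2 ^ ℓ * R.τ k ≤ 2 * M := by
  classical
  have hex : ∃ ℓ : ℕ, L ≤ 2 ^ ℓ * R.τ k := by
    obtain ⟨ℓ, hℓ⟩ := pow_unbounded_of_one_lt (L / R.τ k) (one_lt_two : (1 : ℝ) < 2)
    exact ⟨ℓ, ((div_lt_iff₀ hτ).1 hℓ).le⟩
  -- The least `ℓ` that overestimates `L`; success may come earlier, which only makes `2 ^ ℓ * R.τ
  -- k` smaller.
  set ℓ₁ := Nat.find hex with hℓ₁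
  have h1 : L ≤ 2 ^ ℓ₁ * R.τ k := Nat.find_spec hex
  have h2 : 2 ^ ℓ₁ * R.τ k ≤ 2 * M := by
    rcases hz : ℓ₁ with _ | j
    · rw [pow_zero]
      linarith
    · have := Nat.find_min hex (m := j) (by omega)
      rw [not_le] at this
      rw [pow_succ]
      linarith
  have hex2 : ∃ ℓ ≤ ℓ₁, R.CallSuccess f ψ m ε k ℓ := by
    by_contra! hno
    have hr : R.Reached f ψ m ε k ℓ₁ :=
      Trace.reached_of_not_callSuccess h0 ℓ₁ fun ℓ' h => hno ℓ' h.le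
    refine hno ℓ₁ le_rfl (success_of_not_found hn hf hL0 hL hτ hε hm (hτ.trans_le hτM) h1 h2
      (hR.call k ℓ₁ hr) fun t ht hc => ?_)
    by_contra! hle
    exact hnot ⟨ℓ₁, t, hr, ht, hc, hle⟩
  have hex3 : ∃ ℓ, R.CallSuccess f ψ m ε k ℓ := hex2.imp fun _ h => h.2
  refine ⟨Nat.find hex3, Nat.find_spec hex3,
    Trace.reached_of_not_callSuccess h0 _ fun ℓ' h => Nat.find_min hex3 h, h2.trans' ?_⟩
  obtain ⟨ℓ, hℓ, hs⟩ := hex2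
  gcongr
  · norm_num
  · exact (Nat.find_min' hex3 hs).trans hℓ

/-- The Hessian takes `4 n ^ 2` evaluations and each step at most `2 n + 3 ≤ 5 n`. -/
theorem Trace.callEvals_le (R : Trace n) (hn : 0 < n) (k ℓ : ℕ) :
    R.callEvals f ψ m ε k ℓ ≤ 5 * (m * n + n ^ 2) := by
  classical
  have h1 : (fdHessQueries (R.x k) (hessStep n m ε (R.τ k) ℓ)).length = 4 * n ^ 2 := by
    simp [fdHessQueries, List.length_flatMap]
    ring
  have h2 : ∀ t, (stepQueries m (sigma m (R.τ k) ℓ) ε (R.y k ℓ) t).length = 2 * n + 3 := by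
    intro t
    simp [stepQueries, fdGradQueries, List.length_flatMap]
    ring
  have h3 : (∑ t ∈ Finset.range m,
      if StepPerformed f ψ (sigma m (R.τ k) ℓ) m ε (R.y k ℓ) t then
        (stepQueries m (sigma m (R.τ k) ℓ) ε (R.y k ℓ) t).length
      else 0) ≤ ∑ _t ∈ Finset.range m, (2 * n + 3) :=
    Finset.sum_le_sum fun t _ => by
      rw [h2]
      split_ifs <;> omega
  rw [Finset.sum_const, Finset.card_range, smul_eq_mul] at h3
  unfold Trace.callEvals
  rw [h1]
  nlinarith [Nat.mul_le_mul_left m hn]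

open Classical in
theorem Trace.tsum_callEvals_le (hn : 0 < n) {k ℓ : ℕ} (hs : R.CallSuccess f ψ m ε k ℓ) :
    (∑' ℓ : ℕ, if R.Reached f ψ m ε k ℓ then (R.callEvals f ψ m ε k ℓ : ℝ≥0∞) else 0)
      ≤ ENNReal.ofReal (5 * (m * n + n ^ 2) * (ℓ + 1)) := by
  rw [tsum_eq_sum (s := Finset.range (ℓ + 1)) fun j hj => if_neg fun hr =>
    hr.not_callSuccess ℓ (by simpa using hj) hs]
  calc _ ≤ ∑ _j ∈ Finset.range (ℓ + 1), ((5 * (m * n + n ^ 2) : ℕ) : ℝ≥0∞) :=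
        Finset.sum_le_sum fun j _ => by
          split_ifs
          · exact_mod_cast Trace.callEvals_le R hn k j
          · exact zero_le
    _ = ENNReal.ofReal ((5 * (m * n + n ^ 2) * (ℓ + 1) : ℕ) : ℝ) := by
        rw [ENNReal.ofReal_natCast, Finset.sum_const, Finset.card_range, nsmul_eq_mul]
        push_cast
        ring
    _ = _ := by push_cast; rfl

/-- Guaranteed decrease of the objective in an iteration that does not find an approximate
second-order point. -/
def iterDecrease (m : ℕ) (ε M : ℝ) : ℝ :=
  Real.sqrt ε ^ 3 * Real.sqrt m / (384 * Real.sqrt (2 ^ 5 * (2 / 3 : ℝ) ^ (1 / 3 : ℝ) * M))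

theorem iterDecrease_pos (hm : 0 < m) (hε : 0 < ε) (hM : 0 < M) : 0 < iterDecrease m ε M := by
  have : 0 < Real.sqrt m := Real.sqrt_pos.2 (by exact_mod_cast hm)
  have : 0 < Real.sqrt ε := Real.sqrt_pos.2 hε
  unfold iterDecrease
  positivity

/-- The right side is the threshold of the last progress test. It decreases in `σ`, which is at most
`2 ^ 5 (2/3)^(1/3) M m`; the factor `√m` from `√σ` reduces `m` to `√m`. -/
theorem iterDecrease_le (hm : 0 < m) (hε : 0 < ε) {τ : ℝ} {ℓ : ℕ} (hτ : 0 < τ)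
    (hτM : 2 ^ ℓ * τ ≤ 2 * M) :
    iterDecrease m ε M ≤ ε ^ (3 / 2 : ℝ) / (384 * sigma m τ ℓ ^ (1 / 2 : ℝ)) * m := by
  have hm' : (0 : ℝ) < m := by exact_mod_cast hm
  have hσ : 0 < sigma m τ ℓ := by
    unfold sigma
    positivity
  rw [rpow_three_halves hε.le, ← Real.sqrt_eq_rpow, iterDecrease]
  have hc : (0 : ℝ) < (2 / 3 : ℝ) ^ (1 / 3 : ℝ) := by positivity
  have h1 : Real.sqrt (sigma m τ ℓ)
      ≤ Real.sqrt (2 ^ 5 * (2 / 3 : ℝ) ^ (1 / 3 : ℝ) * M) * Real.sqrt m := by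
    rw [← Real.sqrt_mul' _ hm'.le]
    refine Real.sqrt_le_sqrt ?_
    unfold sigma
    calc _ ≤ 2 ^ 4 * (2 / 3 : ℝ) ^ (1 / 3 : ℝ) * (2 * M) * m := by gcongr
      _ = _ := by ring
  have hM : 0 < M := by
    have : 0 < 2 ^ ℓ * τ := by positivity
    linarith
  have h2 : 0 < Real.sqrt (2 ^ 5 * (2 / 3 : ℝ) ^ (1 / 3 : ℝ) * M) := Real.sqrt_pos.2 (by positivity)
  have hs : 0 < Real.sqrt m := Real.sqrt_pos.2 hm'
  have h3 : Real.sqrt m * Real.sqrt m = m := Real.mul_self_sqrt hm'.le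
  rw [div_mul_eq_mul_div, div_le_div_iff₀ (by positivity) (by positivity)]
  calc Real.sqrt ε ^ 3 * Real.sqrt m * (384 * Real.sqrt (sigma m τ ℓ))
      ≤ Real.sqrt ε ^ 3 * Real.sqrt m * (384 *
        (Real.sqrt (2 ^ 5 * (2 / 3 : ℝ) ^ (1 / 3 : ℝ) * M) * Real.sqrt m)) := by gcongr
    _ = _ := by
        linear_combination
          (384 * Real.sqrt ε ^ 3 * Real.sqrt (2 ^ 5 * (2 / 3 : ℝ) ^ (1 / 3 : ℝ) * M)) * h3

theorem div_iterDecrease (hε : 0 < ε) (hM : 0 < M) (Δ : ℝ) :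
    Δ / iterDecrease m ε M = 384 * (2 : ℝ) ^ (5 / 2 : ℝ) * (2 / 3 : ℝ) ^ (1 / 6 : ℝ) *
      M ^ (1 / 2 : ℝ) * Δ / Real.sqrt m * ε ^ (-(3 / 2) : ℝ) := by
  have h1 : Real.sqrt (2 ^ 5 * (2 / 3 : ℝ) ^ (1 / 3 : ℝ) * M)
      = (2 : ℝ) ^ (5 / 2 : ℝ) * (2 / 3 : ℝ) ^ (1 / 6 : ℝ) * M ^ (1 / 2 : ℝ) := by
    rw [Real.sqrt_eq_rpow, Real.mul_rpow (by positivity) hM.le,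
      Real.mul_rpow (by positivity) (by positivity), ← Real.rpow_mul (by norm_num),
      ← Real.rpow_natCast, ← Real.rpow_mul (by norm_num)]
    norm_num
  rw [iterDecrease, h1, Real.rpow_neg hε.le, rpow_three_halves hε.le, div_div_eq_mul_div]
  simp only [div_eq_mul_inv, mul_inv]
  ring

/-- The state of the method before iteration `k`, when no earlier iteration has found an
approximate second-order point. -/
theorem IsRun.invariants (hR : IsRun f ψ x₀ τ₀ m ε R) (hn : 0 < n) (hf : ContDiff ℝ 2 f)
    (hL0 : 0 ≤ L) (hL : ∀ x y, ‖hess f y - hess f x‖ ≤ L * ‖y - x‖) (hx₀ : x₀ ∈ effDom ψ)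
    (hε : 0 < ε) (hm : 0 < m) (hτ₀ : 0 < τ₀) (hτM : τ₀ ≤ M) (hLM : L ≤ M) (k : ℕ)
    (hnot : ∀ j < k, ¬ R.FindsSecondOrderPoint f ψ m ε M j) :
    R.Reached f ψ m ε k 0 ∧ τ₀ ≤ R.τ k ∧ R.τ k ≤ M ∧ R.x k ∈ effDom ψ ∧
      objective f ψ (R.x k) ≤ objective f ψ x₀ - k * iterDecrease m ε M ∧
      R.totalEvals f ψ m ε k ≤
        ENNReal.ofReal (5 * (m * n + n ^ 2) * (2 * k + Real.logb 2 (R.τ k / τ₀))) := by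
  induction k with
  | zero =>
    refine ⟨.start, hR.τ_zero.ge, hR.τ_zero.trans_le hτM, hR.x_zero ▸ hx₀, ?_, ?_⟩
    · simp [hR.x_zero]
    · simp [Trace.totalEvals]
  | succ k ih =>
    obtain ⟨hr, hτk, hτkM, hxk, hobj, hev⟩ := ih fun j hj => hnot j (by omega)
    have hτpos := hτ₀.trans_le hτk
    obtain ⟨ℓ, hs, hrℓ, hℓ⟩ := hR.exists_callSuccess hn hf hL0 hL hε hm hLM hτpos hτkM hr
      (hnot k k.lt_succ_self)
    have hx := hR.x_succ k ℓ hrℓ hs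
    have hτ := hR.τ_succ k ℓ hrℓ hs
    have hcall := hR.call k ℓ hrℓ
    have h2 : (2 : ℝ) ^ ((ℓ : ℤ) - 1) = 2 ^ ℓ / 2 := by
      rw [zpow_sub_one₀ two_ne_zero, zpow_natCast, div_eq_mul_inv]
    rw [h2] at hτ
    -- The last step, of index `m - 1`, gives both the full decrease, through its test, and
    -- membership of the new point in the domain.
    obtain ⟨t, rfl⟩ : ∃ t, m = t + 1 := ⟨m - 1, by omega⟩
    have hstep := hcall.step t ⟨t.lt_succ_self, fun r hr => hs r (by omega)⟩
    have htest := hs t t.lt_succ_self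
    refine ⟨.next k ℓ hrℓ hs, hτ ▸ le_max_left _ _, hτ ▸ max_le hτM (by linarith),
      hx ▸ hstep.subgradient.1, ?_, ?_⟩
    · have h3 := iterDecrease_le hm hε hτpos hℓ
      unfold TestPassed at htest
      rw [hcall.start] at htest
      rw [hx]
      push_cast at *
      linarith
    · have h3 := Trace.tsum_callEvals_le hn hs
      -- The iteration makes `ℓ + 1 = 2 + (ℓ - 1)` calls, and `ℓ - 1` is at most the increment of
      -- `log₂ τ`, so the sum telescopes.
      have h4 : (ℓ : ℝ) - 1 ≤ Real.logb 2 (R.τ (k + 1) / τ₀) - Real.logb 2 (R.τ k / τ₀) := by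
        have h5 : 2 ^ ℓ / 2 * R.τ k ≤ R.τ (k + 1) := hτ ▸ le_max_right _ _
        have h6 : 0 < 2 ^ ℓ / 2 * R.τ k := by positivity
        have h7 := Real.logb_le_logb_of_le one_lt_two h6 h5
        rw [Real.logb_mul (by positivity) hτpos.ne', Real.logb_div (by positivity) two_ne_zero,
          Real.logb_pow, Real.logb_self_eq_one one_lt_two] at h7
        rw [Real.logb_div (h6.trans_le h5).ne' hτ₀.ne', Real.logb_div hτpos.ne' hτ₀.ne']
        linarith
      have h5 : 0 ≤ Real.logb 2 (R.τ k / τ₀) :=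
        Real.logb_nonneg one_lt_two ((one_le_div hτ₀).2 hτk)
      unfold Trace.totalEvals at hev ⊢
      rw [Finset.sum_range_succ]
      refine (add_le_add hev h3).trans ?_
      rw [← ENNReal.ofReal_add (by positivity) (by positivity), ← mul_add]
      refine ENNReal.ofReal_le_ofReal ?_
      refine mul_le_mul_of_nonneg_left ?_ (by positivity)
      push_cast
      linarith

end Method

end ZOCNM

end

/-! ### The complexity bounds. -/

theorem mainTheorem7 :
    ∃ C : ℝ, 0 < C ∧
      ∀ (n : ℕ) (_hn : 0 < n)
        (f : EuclideanSpace ℝ (Fin n) → ℝ) (_hf : ContDiff ℝ 2 f)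
        (L : ℝ) (_hL : 0 ≤ L)
        (_A1 : ∀ x y : EuclideanSpace ℝ (Fin n),
          ‖ZOCNM.hess f y - ZOCNM.hess f x‖ ≤ L * ‖y - x‖)
        (ψ : EuclideanSpace ℝ (Fin n) → EReal) (_hψ : ZOCNM.IsProperClosedConvex ψ)
        (_hψ2 : ZOCNM.TwiceDifferentiable ψ)
        (_hF : BddBelow (ZOCNM.objective f ψ '' ZOCNM.effDom ψ))
        (x₀ : EuclideanSpace ℝ (Fin n)) (_hx₀ : x₀ ∈ ZOCNM.effDom ψ)
        (τ₀ : ℝ) (_hτ₀ : 0 < τ₀) (ε : ℝ) (_hε : 0 < ε) (m : ℕ) (_hm : 0 < m)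
        (R : ZOCNM.Trace n) (_hR : ZOCNM.IsRun f ψ x₀ τ₀ m ε R),
        ∃ T : ℕ,
          IsLeast {k : ℕ | R.FindsSecondOrderPoint f ψ m ε (max τ₀ L) k} T ∧
          (T : ℝ) ≤ 384 * (2 : ℝ) ^ (5 / 2 : ℝ) * (2 / 3 : ℝ) ^ (1 / 6 : ℝ) *
              (max τ₀ L) ^ (1 / 2 : ℝ) * (ZOCNM.objective f ψ x₀ - ZOCNM.optVal f ψ) /
              Real.sqrt m * ε ^ (-(3 / 2) : ℝ) ∧
          R.totalEvals f ψ m ε T ≤ ENNReal.ofReal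
            (C * (((m : ℝ) * n + (n : ℝ) ^ 2) / Real.sqrt m * (max τ₀ L) ^ (1 / 2 : ℝ) *
                (ZOCNM.objective f ψ x₀ - ZOCNM.optVal f ψ) * ε ^ (-(3 / 2) : ℝ) +
              ((m : ℝ) * n + 3 * (n : ℝ) ^ 2) * Real.logb 2 (max τ₀ L / τ₀))) := by
  classical
  -- The evaluation bound is `5 (m n + n ^ 2) (2 T + log₂ (M / τ₀))` with `T ≤ K X`, whence `10 K`
  -- for the first term and `5` for the second.
  refine ⟨10 * (384 * (2 : ℝ) ^ (5 / 2 : ℝ) * (2 / 3 : ℝ) ^ (1 / 6 : ℝ)) + 5, by positivity, ?_⟩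
  intro n hn f hf L hL A1 ψ _ _ hF x₀ hx₀ τ₀ hτ₀ ε hε m hm R hR
  set M := max τ₀ L
  set Δ := ZOCNM.objective f ψ x₀ - ZOCNM.optVal f ψ
  have hM : 0 < M := hτ₀.trans_le (le_max_left _ _)
  have hdec := ZOCNM.iterDecrease_pos hm hε hM
  have inv := hR.invariants hn hf hL A1 hx₀ hε hm hτ₀ (le_max_left τ₀ L) (le_max_right τ₀ L)
  have hbound : ∀ k : ℕ, (∀ j < k, ¬ R.FindsSecondOrderPoint f ψ m ε M j) →
      (k : ℝ) ≤ Δ / ZOCNM.iterDecrease m ε M := by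
    intro k hk
    obtain ⟨-, -, -, hxk, hobj, -⟩ := inv k hk
    have : ZOCNM.optVal f ψ ≤ ZOCNM.objective f ψ (R.x k) :=
      csInf_le hF (Set.mem_image_of_mem _ hxk)
    rw [le_div_iff₀ hdec]
    linarith
  have hex : ∃ k, R.FindsSecondOrderPoint f ψ m ε M k := by
    by_contra! hno
    obtain ⟨k, hk⟩ := exists_nat_gt (Δ / ZOCNM.iterDecrease m ε M)
    exact absurd (hbound k fun j _ => hno j) (not_le.2 hk)
  have hmin : ∀ j < Nat.find hex, ¬ R.FindsSecondOrderPoint f ψ m ε M j := fun j hj =>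
    Nat.find_min hex hj
  have hT := hbound _ hmin
  obtain ⟨-, hτT, hτTM, -, -, hev⟩ := inv _ hmin
  refine ⟨Nat.find hex, ⟨Nat.find_spec hex, fun k hk => Nat.find_min' hex hk⟩, ?_, ?_⟩
  · rwa [ZOCNM.div_iterDecrease hε hM] at hT
  · refine hev.trans (ENNReal.ofReal_le_ofReal ?_)
    generalize Nat.find hex = T at *
    have hlog : Real.logb 2 (R.τ T / τ₀) ≤ Real.logb 2 (M / τ₀) :=
      Real.logb_le_logb_of_le one_lt_two (div_pos (hτ₀.trans_le hτT) hτ₀) (by gcongr)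
    have hlog0 : 0 ≤ Real.logb 2 (M / τ₀) :=
      Real.logb_nonneg one_lt_two ((one_le_div hτ₀).2 (le_max_left _ _))
    rw [ZOCNM.div_iterDecrease hε hM] at hT
    have hT0 : (0 : ℝ) ≤ T := Nat.cast_nonneg T
    set K : ℝ := 384 * (2 : ℝ) ^ (5 / 2 : ℝ) * (2 / 3 : ℝ) ^ (1 / 6 : ℝ)
    have hK : 0 < K := by positivity
    have hmn : (0 : ℝ) ≤ (m : ℝ) * n + (n : ℝ) ^ 2 := by positivity
    have hX : (T : ℝ) ≤ K * (M ^ (1 / 2 : ℝ) * Δ / Real.sqrt m * ε ^ (-(3 / 2) : ℝ)) :=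
      hT.trans_eq (by ring)
    have hY : ((m : ℝ) * n + (n : ℝ) ^ 2) / Real.sqrt m * M ^ (1 / 2 : ℝ) * Δ * ε ^ (-(3 / 2) : ℝ)
        = ((m : ℝ) * n + (n : ℝ) ^ 2) *
          (M ^ (1 / 2 : ℝ) * Δ / Real.sqrt m * ε ^ (-(3 / 2) : ℝ)) := by ring
    rw [hY]
    generalize M ^ (1 / 2 : ℝ) * Δ / Real.sqrt m * ε ^ (-(3 / 2) : ℝ) = X at *
    -- The sign comes from `0 ≤ T ≤ K * X`.
    have hX0 : 0 ≤ X := nonneg_of_mul_nonneg_right (hT0.trans hX) hK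
    calc 5 * ((m : ℝ) * n + (n : ℝ) ^ 2) * (2 * T + Real.logb 2 (R.τ T / τ₀))
        ≤ 5 * ((m : ℝ) * n + (n : ℝ) ^ 2) * (2 * (K * X) + Real.logb 2 (M / τ₀)) := by gcongr
      _ = 10 * K * (((m : ℝ) * n + (n : ℝ) ^ 2) * X)
          + 5 * (((m : ℝ) * n + (n : ℝ) ^ 2) * Real.logb 2 (M / τ₀)) := by ring
      _ ≤ (10 * K + 5) * (((m : ℝ) * n + (n : ℝ) ^ 2) * X)
          + (10 * K + 5) * (((m : ℝ) * n + 3 * (n : ℝ) ^ 2) * Real.logb 2 (M / τ₀)) := by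
        gcongr
        · linarith
        · linarith
        · nlinarith [sq_nonneg (n : ℝ)]
      _ = _ := by ring
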